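/- Let $d\in\mathbb{N}$. Let $\mathcal{O}_C'(\mathbb{R}^d)$ be the space of rapidly decreasing distributions, i.e. of the tempered distributions $u\in\mathcal{S}'(\mathbb{R}^d)$ such that for every $k\in\mathbb{N}$ the distribution $(1+|x|^2)^{k/2}u$ is bounded, which means that there are $C$ and $m$ with $$|\langle (1+|x|^2)^{k/2}u,\varphi\rangle|\le C\sum_{|\alpha|\le m}\|\partial^\alpha\varphi\|_{L^1}\qquad\text{for all }\varphi\in\mathcal{S}(\mathbb{R}^d).$$ For $f\in\mathcal{S}(\mathbb{R}^d)$ and $q,l\in\mathbb{N}$ put $\mu_{q,l}(f)=\sup_{x\in\mathbb{R}^d,\,|\alpha|\le l}(1+|x|)^q|\partial^\alpha f(x)|$. Let $\mathcal{X}_{\mathcal{S}}(\mathbb{R}^d)$ be the space of nets $(f_\varepsilon)_{\varepsilon}\in\mathcal{S}(\mathbb{R}^d)^{(0,1]}$ for which there is $N:\mathbb{N}^2\to\mathbb{R}_+$ with $\mu_{q,l}(f_\varepsilon)=O(\varepsilon^{-N(q,l)})$ as $\varepsilon\to0$ for all $q,l\in\mathbb{N}$, and $\mathcal{N}_{\mathcal{S}}(\mathbb{R}^d)$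 the space of nets with $\mu_{q,l}(f_\varepsilon)=O(\varepsilon^{m})$ as $\varepsilon\to0$ for all $q,l,m\in\mathbb{N}$. Let $\mathcal{G}_{\mathcal{S}}(\mathbb{R}^d)=\mathcal{X}_{\mathcal{S}}(\mathbb{R}^d)/\mathcal{N}_{\mathcal{S}}(\mathbb{R}^d)$ be the space of rapidly decreasing generalized functions, with the class of $(f_\varepsilon)_\varepsilon$ written $[(f_\varepsilon)_\varepsilon]_{\mathcal{S}}$ and with $\partial_j[(f_\varepsilon)_\varepsilon]_{\mathcal{S}}=[(\partial_jf_\varepsilon)_\varepsilon]_{\mathcal{S}}$. Let $\rho\in\mathcal{S}(\mathbb{R}^d)$ satisfy $\int\rho(x)\,dx=1$ and $\int x^m\rho(x)\,dx=0$ for all $m\in\mathbb{N}^d\setminus\{0\}$, and put $\rho_\varepsilon(x)=\varepsilon^{-d}\rho(x/\varepsilon)$ for $\varepsilon\in(0,1]$. **Theorem.** For every $u\in\mathcal{O}_C'(\mathbb{R}^d)$ the functions $u*\rho_\varepsilon:x\mapsto\langle u,\rho_\varepsilon(x-\cdot)\rangle$ belong to $\mathcal{S}(\mathbb{R}^d)$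 and form a net in $\mathcal{X}_{\mathcal{S}}(\mathbb{R}^d)$. The map $$\iota_{\mathcal{S}}:\mathcal{O}_C'(\mathbb{R}^d)\to\mathcal{G}_{\mathcal{S}}(\mathbb{R}^d),\qquad u\mapsto[(u*\rho_\varepsilon)_\varepsilon]_{\mathcal{S}},$$ is $\mathbb{C}$-linear and injective. It commutes with partial derivatives: for every $u\in\mathcal{O}_C'(\mathbb{R}^d)$ and $1\le j\le d$ one has $\partial_ju\in\mathcal{O}_C'(\mathbb{R}^d)$ and $\iota_{\mathcal{S}}(\partial_ju)=\partial_j\,\iota_{\mathcal{S}}(u)$. -/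

import Mathlib

open scoped SchwartzMap LineDeriv Topology NNReal

noncomputable section

namespace RapidlyDecreasing

/-- The Euclidean space `ℝ^d`. -/
abbrev Eucl (d : ℕ) : Type := EuclideanSpace ℝ (Fin d)

variable {d : ℕ}

/-- The `j`-th standard basis vector of `ℝ^d`; `∂_{e j}` is the `j`-th partial derivative. -/
def e (j : Fin d) : Eucl d := EuclideanSpace.single j 1

/-- The higher partial derivative `∂_{s 0} ∂_{s 1} ⋯ ∂_{s (n-1)} f` of a Schwartz function. Since
partial derivatives commute, when `s` runs through all sequences of length `n`, this runs through
the `∂^α f` with `|α| = n`. -/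
def partialDeriv {n : ℕ} (s : Fin n → Fin d) (f : 𝓢(Eucl d, ℂ)) : 𝓢(Eucl d, ℂ) :=
  ∂^{fun i => e (s i)} f

/-! ### Rapidly decreasing distributions -/

/-- The norm `∑_{|α| ≤ m} ‖∂^α φ‖_{L¹}`; for `m = 0, 1, …` these norms define the topology of
`𝓓_{L¹}`. -/
def sobolevL1 (m : ℕ) (φ : 𝓢(Eucl d, ℂ)) : ℝ :=
  ∑ n ∈ Finset.range (m + 1), ∑ s : Fin n → Fin d, ∫ x, ‖partialDeriv s φ x‖

/-- A tempered distribution is bounded if it is continuous for the topology of `𝓓_{L¹}`, i.e. if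
it belongs to the dual `𝓑' = 𝓓'_{L^∞}` of `𝓓_{L¹}`, in which the Schwartz functions are dense. -/
def IsBoundedDistribution (T : 𝓢'(Eucl d, ℂ)) : Prop :=
  ∃ (C : ℝ) (m : ℕ), ∀ φ : 𝓢(Eucl d, ℂ), ‖T φ‖ ≤ C * sobolevL1 m φ

/-- The weight `(1 + |x|²)^(k/2)`. -/
def weight (k : ℕ) (x : Eucl d) : ℂ := (((1 + ‖x‖ ^ 2) ^ ((k : ℝ) / 2) : ℝ) : ℂ)

/-- The weight has temperate growth, so that multiplication by it is the genuine one. -/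
theorem weight_hasTemperateGrowth (k : ℕ) :
    (weight k : Eucl d → ℂ).HasTemperateGrowth :=
  Function.HasTemperateGrowth.comp Function.Complex.hasTemperateGrowth_ofReal
    (Function.hasTemperateGrowth_one_add_norm_sq_rpow (Eucl d) ((k : ℝ) / 2))

theorem sobolevL1_nonneg (m : ℕ) (φ : 𝓢(Eucl d, ℂ)) : 0 ≤ sobolevL1 m φ :=
  Finset.sum_nonneg fun _ _ => Finset.sum_nonneg fun _ _ =>
    MeasureTheory.integral_nonneg fun _ => norm_nonneg _

theorem sobolevL1_mono {m m' : ℕ} (h : m ≤ m') (φ : 𝓢(Eucl d, ℂ)) :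
    sobolevL1 m φ ≤ sobolevL1 m' φ :=
  Finset.sum_le_sum_of_subset_of_nonneg (Finset.range_mono (by omega))
    fun _ _ _ => Finset.sum_nonneg fun _ _ =>
      MeasureTheory.integral_nonneg fun _ => norm_nonneg _

theorem IsBoundedDistribution.zero : IsBoundedDistribution (0 : 𝓢'(Eucl d, ℂ)) :=
  ⟨0, 0, fun φ => by simp⟩

theorem IsBoundedDistribution.add {T U : 𝓢'(Eucl d, ℂ)} (hT : IsBoundedDistribution T)
    (hU : IsBoundedDistribution U) : IsBoundedDistribution (T + U) := by
  obtain ⟨C, m, h⟩ := hT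
  obtain ⟨C', m', h'⟩ := hU
  refine ⟨|C| + |C'|, max m m', fun φ => ?_⟩
  have h1 : C * sobolevL1 m φ ≤ |C| * sobolevL1 (max m m') φ :=
    mul_le_mul (le_abs_self C) (sobolevL1_mono (le_max_left _ _) φ) (sobolevL1_nonneg _ _)
      (abs_nonneg _)
  have h2 : C' * sobolevL1 m' φ ≤ |C'| * sobolevL1 (max m m') φ :=
    mul_le_mul (le_abs_self C') (sobolevL1_mono (le_max_right _ _) φ) (sobolevL1_nonneg _ _)
      (abs_nonneg _)
  have h3 : ‖(T + U) φ‖ ≤ ‖T φ‖ + ‖U φ‖ := norm_add_le (T φ) (U φ)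
  have h4 := h φ
  have h5 := h' φ
  rw [add_mul]
  linarith

theorem IsBoundedDistribution.smul {T : 𝓢'(Eucl d, ℂ)} (c : ℂ) (hT : IsBoundedDistribution T) :
    IsBoundedDistribution (c • T) := by
  obtain ⟨C, m, h⟩ := hT
  refine ⟨‖c‖ * C, m, fun φ => ?_⟩
  have h3 : ‖(c • T) φ‖ = ‖c‖ * ‖T φ‖ := norm_smul c (T φ)
  rw [h3, mul_assoc]
  exact mul_le_mul_of_nonneg_left (h φ) (norm_nonneg _)

/-- The space `𝓞_C'(ℝ^d)` of rapidly decreasing distributions: those `u` for which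
`(1 + |x|²)^(k/2) u` is a bounded distribution for every `k`. -/
def OC' (d : ℕ) : Submodule ℂ 𝓢'(Eucl d, ℂ) where
  carrier := {u | ∀ k : ℕ, IsBoundedDistribution (TemperedDistribution.smulLeftCLM ℂ (weight k) u)}
  zero_mem' k := by
    rw [map_zero]
    exact IsBoundedDistribution.zero
  add_mem' {u v} hu hv k := by
    rw [map_add]
    exact (hu k).add (hv k)
  smul_mem' c u hu k := by
    rw [map_smul]
    exact (hu k).smul c

/-! ### Rapidly decreasing generalized functions -/

/-- The seminorm `μ_{q,l}(f) = sup_{x ∈ ℝ^d, |α| ≤ l} (1 + |x|)^q |∂^α f(x)|`. -/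
def mu (q l : ℕ) (f : 𝓢(Eucl d, ℂ)) : ℝ :=
  ⨆ p : Eucl d × (Σ n : Fin (l + 1), (Fin n → Fin d)),
    (1 + ‖p.1‖) ^ q * ‖partialDeriv p.2.2 f p.1‖

/-- The supremum that defines `μ_{q,l}(f)` is finite. -/
theorem mu_bddAbove (q l : ℕ) (f : 𝓢(Eucl d, ℂ)) :
    BddAbove (Set.range fun p : Eucl d × (Σ n : Fin (l + 1), (Fin n → Fin d)) =>
      (1 + ‖p.1‖) ^ q * ‖partialDeriv p.2.2 f p.1‖) := by
  have hb : ∀ a : (Σ n : Fin (l + 1), (Fin n → Fin d)), ∃ B : ℝ, ∀ x : Eucl d,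
      (1 + ‖x‖) ^ q * ‖partialDeriv a.2 f x‖ ≤ B := fun a => by
    refine ⟨2 ^ q * (Finset.Iic (q, 0)).sup (fun m => SchwartzMap.seminorm ℂ m.1 m.2)
      (partialDeriv a.2 f), fun x => ?_⟩
    have := SchwartzMap.one_add_le_sup_seminorm_apply (𝕜 := ℂ) (m := (q, 0)) le_rfl le_rfl
      (partialDeriv a.2 f) x
    simpa using this
  choose B hB using hb
  refine ⟨∑ a, |B a|, ?_⟩
  rintro _ ⟨⟨x, a⟩, rfl⟩
  exact (hB a x).trans ((le_abs_self _).trans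
    (Finset.single_le_sum (f := fun a => |B a|) (fun _ _ => abs_nonneg _) (Finset.mem_univ a)))

theorem le_mu {q l n : ℕ} (hn : n ≤ l) (s : Fin n → Fin d) (f : 𝓢(Eucl d, ℂ)) (x : Eucl d) :
    (1 + ‖x‖) ^ q * ‖partialDeriv s f x‖ ≤ mu q l f :=
  le_ciSup (mu_bddAbove q l f) (x, ⟨⟨n, by omega⟩, s⟩)

theorem mu_le {q l : ℕ} {f : 𝓢(Eucl d, ℂ)} {B : ℝ}
    (h : ∀ (n : ℕ) (_ : n ≤ l) (s : Fin n → Fin d) (x : Eucl d),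
      (1 + ‖x‖) ^ q * ‖partialDeriv s f x‖ ≤ B) : mu q l f ≤ B := by
  have : Nonempty (Eucl d × (Σ n : Fin (l + 1), (Fin n → Fin d))) :=
    ⟨(0, ⟨0, fun i => i.elim0⟩)⟩
  exact ciSup_le fun p => h _ (by have := p.2.1.2; omega) p.2.2 p.1

theorem mu_nonneg (q l : ℕ) (f : 𝓢(Eucl d, ℂ)) : 0 ≤ mu q l f :=
  Real.iSup_nonneg fun _ => by positivity

theorem mu_zero (q l : ℕ) : mu q l (0 : 𝓢(Eucl d, ℂ)) = 0 :=
  le_antisymm (mu_le fun n _ s x => by simp [partialDeriv, LineDeriv.iteratedLineDerivOp_zero])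
    (mu_nonneg _ _ _)

theorem mu_add_le (q l : ℕ) (f g : 𝓢(Eucl d, ℂ)) : mu q l (f + g) ≤ mu q l f + mu q l g := by
  refine mu_le fun n hn s x => ?_
  have h : partialDeriv s (f + g) x = partialDeriv s f x + partialDeriv s g x := by
    simp [partialDeriv, LineDeriv.iteratedLineDerivOp_add]
  rw [h]
  calc (1 + ‖x‖) ^ q * ‖partialDeriv s f x + partialDeriv s g x‖
      ≤ (1 + ‖x‖) ^ q * (‖partialDeriv s f x‖ + ‖partialDeriv s g x‖) := by
        gcongr
        exact norm_add_le _ _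
    _ ≤ _ := by
        rw [mul_add]
        exact add_le_add (le_mu hn s f x) (le_mu hn s g x)

theorem mu_smul_le (q l : ℕ) (c : ℂ) (f : 𝓢(Eucl d, ℂ)) : mu q l (c • f) ≤ ‖c‖ * mu q l f := by
  refine mu_le fun n hn s x => ?_
  have h : partialDeriv s (c • f) x = c * partialDeriv s f x := by
    simp [partialDeriv, LineDeriv.iteratedLineDerivOp_smul]
  rw [h, norm_mul, mul_left_comm]
  exact mul_le_mul_of_nonneg_left (le_mu hn s f x) (norm_nonneg _)

theorem mu_lineDeriv_le (q l : ℕ) (j : Fin d) (f : 𝓢(Eucl d, ℂ)) :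
    mu q l (∂_{e j} f : 𝓢(Eucl d, ℂ)) ≤ mu q (l + 1) f := by
  refine mu_le fun n hn s x => ?_
  have h : partialDeriv s (∂_{e j} f : 𝓢(Eucl d, ℂ)) =
      partialDeriv (Fin.snoc (α := fun _ => Fin d) s j : Fin (n + 1) → Fin d) f := by
    unfold partialDeriv
    rw [LineDeriv.iteratedLineDerivOp_succ_right]
    simp [Fin.init_def]
  rw [h]
  exact le_mu (by omega) _ f x

/-- Nets `(f_ε)_{0 < ε ≤ 1}` of Schwartz functions on `ℝ^d`. -/
abbrev Net (d : ℕ) : Type := Set.Ioc (0 : ℝ) 1 → 𝓢(Eucl d, ℂ)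

/-- The filter `ε → 0` on the parameter set `(0, 1]`. -/
def epsToZero : Filter (Set.Ioc (0 : ℝ) 1) := Filter.comap Subtype.val (𝓝 (0 : ℝ))

/-- `𝓧_𝓢(ℝ^d)`: the moderate nets, i.e. those for which there is `N : ℕ² → ℝ₊` with
`μ_{q,l}(f_ε) = O(ε^(-N(q,l)))` as `ε → 0`, for all `q, l`. -/
def XS (d : ℕ) : Submodule ℂ (Net d) where
  carrier := {f | ∃ N : ℕ → ℕ → ℝ≥0, ∀ q l : ℕ,
    (fun ε => mu q l (f ε)) =O[epsToZero] fun ε => (ε : ℝ) ^ (-(N q l : ℝ))}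
  zero_mem' := ⟨fun _ _ => 0, fun q l => by
    simp only [Pi.zero_apply, mu_zero]
    exact Asymptotics.isBigO_zero _ _⟩
  add_mem' := by
    rintro f g ⟨N, hN⟩ ⟨M, hM⟩
    refine ⟨fun q l => max (N q l) (M q l), fun q l => ?_⟩
    have key : ∀ K : ℝ≥0, K ≤ max (N q l) (M q l) →
        (fun ε : Set.Ioc (0 : ℝ) 1 => (ε : ℝ) ^ (-(K : ℝ))) =O[epsToZero]
          fun ε => (ε : ℝ) ^ (-((max (N q l) (M q l) : ℝ≥0) : ℝ)) := fun K hK =>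
      Asymptotics.IsBigO.of_bound 1 (Filter.Eventually.of_forall fun ε => by
        have h0 : (0 : ℝ) < ε := ε.2.1
        rw [one_mul, Real.norm_of_nonneg (Real.rpow_nonneg h0.le _),
          Real.norm_of_nonneg (Real.rpow_nonneg h0.le _)]
        exact Real.rpow_le_rpow_of_exponent_ge h0 ε.2.2 (neg_le_neg (NNReal.coe_le_coe.2 hK)))
    refine Asymptotics.IsBigO.trans (g := fun ε => mu q l (f ε) + mu q l (g ε)) ?_
      (((hN q l).trans (key _ (le_max_left _ _))).add ((hM q l).trans (key _ (le_max_right _ _))))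
    exact Asymptotics.IsBigO.of_bound 1 (Filter.Eventually.of_forall fun ε => by
      rw [one_mul, Real.norm_of_nonneg (mu_nonneg _ _ _),
        Real.norm_of_nonneg (add_nonneg (mu_nonneg _ _ _) (mu_nonneg _ _ _))]
      exact mu_add_le _ _ _ _)
  smul_mem' := by
    rintro c f ⟨N, hN⟩
    refine ⟨N, fun q l => Asymptotics.IsBigO.trans ?_ (hN q l)⟩
    exact Asymptotics.IsBigO.of_bound ‖c‖ (Filter.Eventually.of_forall fun ε => by
      rw [Real.norm_of_nonneg (mu_nonneg _ _ _), Real.norm_of_nonneg (mu_nonneg _ _ _)]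
      exact mu_smul_le _ _ _ _)

/-- `𝓝_𝓢(ℝ^d)`: the negligible nets, i.e. those with `μ_{q,l}(f_ε) = O(ε^m)` as `ε → 0`, for all
`q, l, m`. -/
def NS (d : ℕ) : Submodule ℂ (Net d) where
  carrier := {f | ∀ q l m : ℕ, (fun ε => mu q l (f ε)) =O[epsToZero] fun ε => (ε : ℝ) ^ m}
  zero_mem' q l m := by
    simp only [Pi.zero_apply, mu_zero]
    exact Asymptotics.isBigO_zero _ _
  add_mem' {f g} hf hg q l m := by
    refine Asymptotics.IsBigO.trans (g := fun ε => mu q l (f ε) + mu q l (g ε)) ?_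
      ((hf q l m).add (hg q l m))
    exact Asymptotics.IsBigO.of_bound 1 (Filter.Eventually.of_forall fun ε => by
      rw [one_mul, Real.norm_of_nonneg (mu_nonneg _ _ _),
        Real.norm_of_nonneg (add_nonneg (mu_nonneg _ _ _) (mu_nonneg _ _ _))]
      exact mu_add_le _ _ _ _)
  smul_mem' c f hf q l m := by
    refine Asymptotics.IsBigO.trans ?_ (hf q l m)
    exact Asymptotics.IsBigO.of_bound ‖c‖ (Filter.Eventually.of_forall fun ε => by
      rw [Real.norm_of_nonneg (mu_nonneg _ _ _), Real.norm_of_nonneg (mu_nonneg _ _ _)]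
      exact mu_smul_le _ _ _ _)

/-- `𝓖_𝓢(ℝ^d) = 𝓧_𝓢(ℝ^d) / 𝓝_𝓢(ℝ^d)`, the rapidly decreasing generalized functions, with their
structure of complex vector space. -/
abbrev GS (d : ℕ) : Type := XS d ⧸ (NS d).submoduleOf (XS d)

/-- The class `[(f_ε)_ε]_𝓢` of a moderate net. -/
def GS.mk : XS d →ₗ[ℂ] GS d := ((NS d).submoduleOf (XS d)).mkQ

/-- The `j`-th partial derivative of nets, taken for each `ε`. -/
def Net.pderiv (j : Fin d) : Net d →ₗ[ℂ] Net d where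
  toFun f ε := ∂_{e j} (f ε)
  map_add' f g := by
    funext ε
    exact LineDerivAdd.lineDerivOp_add (e j) (f ε) (g ε)
  map_smul' c f := by
    funext ε
    exact LineDerivSMul.lineDerivOp_smul (e j) c (f ε)

theorem mu_pderiv_isBigO (q l : ℕ) (j : Fin d) (f : Net d) :
    (fun ε => mu q l (Net.pderiv j f ε)) =O[epsToZero] fun ε => mu q (l + 1) (f ε) :=
  Asymptotics.IsBigO.of_bound 1 (Filter.Eventually.of_forall fun ε => by
    rw [one_mul, Real.norm_of_nonneg (mu_nonneg _ _ _), Real.norm_of_nonneg (mu_nonneg _ _ _)]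
    exact mu_lineDeriv_le _ _ _ _)

/-- The `j`-th partial derivative of moderate nets. -/
def XS.pderiv (j : Fin d) : XS d →ₗ[ℂ] XS d :=
  (Net.pderiv j).restrict fun f hf => by
    obtain ⟨N, hN⟩ := hf
    exact ⟨fun q l => N q (l + 1), fun q l => (mu_pderiv_isBigO q l j f).trans (hN q (l + 1))⟩

/-- The `j`-th partial derivative of rapidly decreasing generalized functions,
`∂_j [(f_ε)_ε]_𝓢 = [(∂_j f_ε)_ε]_𝓢`. -/
def GS.pderiv (j : Fin d) : GS d →ₗ[ℂ] GS d :=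
  Submodule.mapQ _ _ (XS.pderiv j) fun f hf q l m =>
    (mu_pderiv_isBigO q l j f.1).trans (hf q (l + 1) m)

theorem GS.pderiv_mk (j : Fin d) (f : XS d) :
    GS.pderiv j (GS.mk f) = GS.mk (XS.pderiv j f) := rfl

/-! ### Mollifiers and convolution -/

/-- `ρ ∈ 𝓢(ℝ^d)` with `∫ ρ = 1` and `∫ x^m ρ(x) dx = 0` for all multi-indices `m ≠ 0`. -/
structure IsMollifier (ρ : 𝓢(Eucl d, ℂ)) : Prop where
  integral_eq_one : ∫ x, ρ x = 1
  moment_eq_zero : ∀ m : Fin d → ℕ, m ≠ 0 → ∫ x : Eucl d, ((∏ i, x i ^ m i : ℝ) : ℂ) * ρ x = 0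

/-- The function `ρ_ε(x) = ε^(-d) ρ(x / ε)`. -/
def scale (ρ : 𝓢(Eucl d, ℂ)) (ε : Set.Ioc (0 : ℝ) 1) : 𝓢(Eucl d, ℂ) :=
  (((ε : ℝ) ^ d)⁻¹ : ℂ) • SchwartzMap.compCLMOfContinuousLinearEquiv ℂ
    (ContinuousLinearEquiv.smulLeft (Units.mk0 (ε : ℝ) ε.2.1.ne')⁻¹ : Eucl d ≃L[ℝ] Eucl d) ρ

theorem scale_apply (ρ : 𝓢(Eucl d, ℂ)) (ε : Set.Ioc (0 : ℝ) 1) (x : Eucl d) :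
    scale ρ ε x = (((ε : ℝ) ^ d)⁻¹ : ℂ) * ρ ((ε : ℝ)⁻¹ • x) := rfl

/-- The Schwartz function `y ↦ φ(x - y)`. -/
def reflTranslate (φ : 𝓢(Eucl d, ℂ)) (x : Eucl d) : 𝓢(Eucl d, ℂ) :=
  SchwartzMap.compSubConstCLM ℂ x
    (SchwartzMap.compCLMOfContinuousLinearEquiv ℂ (ContinuousLinearEquiv.neg ℝ) φ)

theorem reflTranslate_apply (φ : 𝓢(Eucl d, ℂ)) (x y : Eucl d) :
    reflTranslate φ x y = φ (x - y) :=
  congrArg φ (neg_sub y x)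

/-- The convolution `(u * φ)(x) = ⟨u, φ(x - ·)⟩` of a tempered distribution and a Schwartz
function. -/
def conv (u : 𝓢'(Eucl d, ℂ)) (φ : 𝓢(Eucl d, ℂ)) (x : Eucl d) : ℂ := u (reflTranslate φ x)

end RapidlyDecreasing

end

noncomputable section

namespace RapidlyDecreasing

variable {d : ℕ}

open MeasureTheory LineDeriv

/-! ### Partial derivatives and the full derivative -/

/-! Boundedness of `(1 + |x|²)^(k/2) u`, tested on `(1 + |x|²)^(-k/2) ψ`, gives for every `k` a
bound of `|u(ψ)|` by the integral of `(1 + |y|²)^(-k/2) ∑ |∂^α ψ(y)|` (`exists_norm_le_integral`).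
The weights pass through the derivatives because every derivative of `(1 + |x|²)^r` is `O((1 +
|x|²)^r)`. Taking `ψ = φ(x - ·)` and using `1 + |x| ≤ (1 + |y|)(1 + |x - y|)` yields `(1 + |x|)^k
|(u * φ)(x)| ≤ C μ_{q,m}(φ)`, uniformly in `φ`.

Taylor's formula in the seminorms `μ_{q,m}` shows `∂^α (u * φ) = u * ∂^α φ`. Hence `u * φ` is a
Schwartz function whose seminorms are controlled by those of `φ`. Since `μ_{q,m}(ρ_ε) ≤ ε^(-(m+d))
μ_{q,m}(ρ)`, the net `u * ρ_ε` is moderate. The same formula shows that the embedding commutes with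
`∂_j`.

For injectivity, pair with a test function: `∫ b(-x) (u * ρ_ε)(x) dx = ∫ ρ_ε(-x) (u * b)(x) dx`. If
the net is negligible, the left side tends to `0`; the right side tends to `(u * b)(0) = ⟨u,
b(-·)⟩`. So `u` vanishes on every test function.

The exchange identity (`integral_mul_conv_comm`) requires moving `u` through an integral of test
functions. For this, `u` is factored by Hahn–Banach through a Banach space of bounded continuous
functions, where Bochner integrals commute with continuous functionals. What remains is a pointwise
identity of ordinary integrals, settled by integration by parts and a change of variable. -/

theorem norm_e (j : Fin d) : ‖(e j : Eucl d)‖ = 1 := by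
  simp [e]

theorem partialDeriv_apply {n : ℕ} (s : Fin n → Fin d) (f : 𝓢(Eucl d, ℂ)) (x : Eucl d) :
    partialDeriv s f x = iteratedFDeriv ℝ n f x (fun i => e (s i)) :=
  SchwartzMap.iteratedLineDerivOp_eq_iteratedFDeriv

theorem partialDeriv_zero (s : Fin 0 → Fin d) (f : 𝓢(Eucl d, ℂ)) : partialDeriv s f = f :=
  iteratedLineDerivOp_fin_zero _ f

theorem partialDeriv_succ {n : ℕ} (s : Fin (n + 1) → Fin d) (f : 𝓢(Eucl d, ℂ)) :
    partialDeriv s f = ∂_{e (s 0)} (partialDeriv (Fin.tail s) f) :=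
  iteratedLineDerivOp_succ_left _ f

theorem partialDeriv_succ' {n : ℕ} (s : Fin (n + 1) → Fin d) (f : 𝓢(Eucl d, ℂ)) :
    partialDeriv s f = partialDeriv (Fin.init s) (∂_{e (s (Fin.last n))} f) :=
  iteratedLineDerivOp_succ_right _ f

theorem partialDeriv_snoc {n : ℕ} (s : Fin n → Fin d) (j : Fin d) (f : 𝓢(Eucl d, ℂ)) :
    partialDeriv (Fin.snoc (α := fun _ => Fin d) s j : Fin (n + 1) → Fin d) f =
      partialDeriv s (∂_{e j} f) := by
  rw [partialDeriv_succ']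
  simp

/-- Partial derivative as a continuous linear map. -/
def partialDerivCLM {n : ℕ} (s : Fin n → Fin d) : 𝓢(Eucl d, ℂ) →L[ℂ] 𝓢(Eucl d, ℂ) :=
  iteratedLineDerivOpCLM ℂ 𝓢(Eucl d, ℂ) (fun i => e (s i))

theorem partialDerivCLM_apply {n : ℕ} (s : Fin n → Fin d) (f : 𝓢(Eucl d, ℂ)) :
    partialDerivCLM s f = partialDeriv s f := by
  simp [partialDerivCLM, partialDeriv]

/-- A multilinear map on `ℝ^d` is bounded by its values on the standard basis. -/
theorem norm_multilinear_le_sum_basis {F : Type*} [NormedAddCommGroup F] [NormedSpace ℝ F] {n : ℕ}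
    (M : ContinuousMultilinearMap ℝ (fun _ : Fin n => Eucl d) F) :
    ‖M‖ ≤ ∑ s : Fin n → Fin d, ‖M fun i => e (s i)‖ := by
  refine ContinuousMultilinearMap.opNorm_le_bound (Finset.sum_nonneg fun _ _ => norm_nonneg _)
    fun v => ?_
  have hv : v = fun i => ∑ j : Fin d, v i j • (e j : Eucl d) := by
    funext i
    have := (EuclideanSpace.basisFun (Fin d) ℝ).sum_repr (v i)
    simpa [e] using this.symm
  have : M v = ∑ s : Fin n → Fin d, (∏ i, v i (s i)) • M fun i => e (s i) := by
    conv_lhs => rw [hv]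
    rw [ContinuousMultilinearMap.map_sum]
    exact Finset.sum_congr rfl fun s _ => ContinuousMultilinearMap.map_smul_univ _ _ _
  rw [this, Finset.sum_mul]
  refine (norm_sum_le _ _).trans (Finset.sum_le_sum fun s _ => ?_)
  rw [norm_smul, mul_comm, norm_prod]
  gcongr with i
  exact PiLp.norm_apply_le (v i) (s i)

/-- The sum of the absolute values of all partial derivatives of order at most `m`. -/
def derivSum (m : ℕ) (f : 𝓢(Eucl d, ℂ)) (x : Eucl d) : ℝ :=
  ∑ n ∈ Finset.range (m + 1), ∑ s : Fin n → Fin d, ‖partialDeriv s f x‖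

theorem derivSum_nonneg (m : ℕ) (f : 𝓢(Eucl d, ℂ)) (x : Eucl d) : 0 ≤ derivSum m f x :=
  Finset.sum_nonneg fun _ _ => Finset.sum_nonneg fun _ _ => norm_nonneg _

theorem sobolevL1_eq_integral (m : ℕ) (f : 𝓢(Eucl d, ℂ)) :
    sobolevL1 m f = ∫ x, derivSum m f x := by
  unfold sobolevL1 derivSum
  rw [integral_finsetSum]
  · refine Finset.sum_congr rfl fun n _ => ?_
    rw [integral_finsetSum]
    exact fun s _ => (partialDeriv s f).integrable.norm
  · exact fun n _ => integrable_finsetSum _ fun s _ => (partialDeriv s f).integrable.norm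

theorem integrable_derivSum (m : ℕ) (f : 𝓢(Eucl d, ℂ)) : Integrable (derivSum m f) :=
  integrable_finsetSum _ fun _ _ => integrable_finsetSum _ fun s _ =>
    (partialDeriv s f).integrable.norm

theorem sum_norm_partialDeriv_le_derivSum {m n : ℕ} (hn : n ≤ m) (f : 𝓢(Eucl d, ℂ)) (x : Eucl d) :
    ∑ s : Fin n → Fin d, ‖partialDeriv s f x‖ ≤ derivSum m f x :=
  Finset.single_le_sum (f := fun n => ∑ s : Fin n → Fin d, ‖partialDeriv s f x‖)
    (fun _ _ => Finset.sum_nonneg fun _ _ => norm_nonneg _) (Finset.mem_range.2 (by omega))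

theorem norm_partialDeriv_le_derivSum {m n : ℕ} (hn : n ≤ m) (s : Fin n → Fin d)
    (f : 𝓢(Eucl d, ℂ)) (x : Eucl d) : ‖partialDeriv s f x‖ ≤ derivSum m f x :=
  (Finset.single_le_sum (f := fun s => ‖partialDeriv s f x‖) (fun _ _ => norm_nonneg _)
    (Finset.mem_univ s)).trans (sum_norm_partialDeriv_le_derivSum hn f x)

theorem norm_iteratedFDeriv_le_derivSum {m n : ℕ} (hn : n ≤ m) (f : 𝓢(Eucl d, ℂ)) (x : Eucl d) :
    ‖iteratedFDeriv ℝ n f x‖ ≤ derivSum m f x := by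
  refine (norm_multilinear_le_sum_basis _).trans ?_
  simp_rw [← partialDeriv_apply]
  exact sum_norm_partialDeriv_le_derivSum hn f x

theorem norm_partialDeriv_le_iteratedFDeriv {n : ℕ} (s : Fin n → Fin d)
    (f : 𝓢(Eucl d, ℂ)) (x : Eucl d) : ‖partialDeriv s f x‖ ≤ ‖iteratedFDeriv ℝ n f x‖ := by
  rw [partialDeriv_apply]
  simpa [norm_e] using (iteratedFDeriv ℝ n f x).le_opNorm (fun i => e (s i))

/-- The number of partial derivatives of order at most `m`, counted as sequences. -/
def numDeriv (d m : ℕ) : ℝ := ∑ n ∈ Finset.range (m + 1), ∑ _s : Fin n → Fin d, (1 : ℝ)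

theorem numDeriv_nonneg (d m : ℕ) : 0 ≤ numDeriv d m :=
  Finset.sum_nonneg fun _ _ => Finset.sum_nonneg fun _ _ => zero_le_one

theorem derivSum_le {m : ℕ} {f : 𝓢(Eucl d, ℂ)} {x : Eucl d} {B : ℝ}
    (h : ∀ n ≤ m, ∀ s : Fin n → Fin d, ‖partialDeriv s f x‖ ≤ B) :
    derivSum m f x ≤ numDeriv d m * B := by
  unfold derivSum numDeriv
  rw [Finset.sum_mul]
  refine Finset.sum_le_sum fun n hn => ?_
  rw [Finset.sum_mul]
  refine Finset.sum_le_sum fun s _ => ?_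
  rw [one_mul]
  exact h n (by have := Finset.mem_range.1 hn; omega) s

theorem pow_mul_derivSum_le_mu (q m : ℕ) (f : 𝓢(Eucl d, ℂ)) (x : Eucl d) :
    (1 + ‖x‖) ^ q * derivSum m f x ≤ numDeriv d m * mu q m f := by
  have h0 : (0 : ℝ) < (1 + ‖x‖) ^ q := by positivity
  have := derivSum_le (m := m) (f := f) (x := x) (B := ((1 + ‖x‖) ^ q)⁻¹ * mu q m f)
    fun n hn s => by
      rw [le_inv_mul_iff₀ h0]
      exact le_mu hn s f x
  calc _ ≤ (1 + ‖x‖) ^ q * (numDeriv d m * (((1 + ‖x‖) ^ q)⁻¹ * mu q m f)) := by gcongr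
    _ = _ := by field_simp

/-- A pointwise Leibniz estimate. -/
theorem exists_derivSum_smulLeft_le {f : Eucl d → ℂ} {g : Eucl d → ℝ} (hf : f.HasTemperateGrowth)
    (hg : ∀ x, 0 ≤ g x) (h : ∀ n : ℕ, ∃ C, ∀ x, ‖iteratedFDeriv ℝ n f x‖ ≤ C * g x) (m : ℕ) :
    ∃ C, 0 ≤ C ∧ ∀ (ψ : 𝓢(Eucl d, ℂ)) (x : Eucl d),
      derivSum m (SchwartzMap.smulLeftCLM ℂ f ψ) x ≤ C * (g x * derivSum m ψ x) := by
  choose C hC using h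
  have hC' : ∀ n x, ‖iteratedFDeriv ℝ n f x‖ ≤ |C n| * g x := fun n x =>
    (hC n x).trans (mul_le_mul_of_nonneg_right (le_abs_self _) (hg x))
  -- The inner sum is the Leibniz constant for order `n`; summing over `n ≤ m` makes one constant
  -- serve all orders.
  let K : ℝ := ∑ n ∈ Finset.range (m + 1), ∑ i ∈ Finset.range (n + 1), (n.choose i : ℝ) * |C i|
  have hK : 0 ≤ K := Finset.sum_nonneg fun n _ => Finset.sum_nonneg fun i _ => by positivity
  refine ⟨numDeriv d m * K, mul_nonneg (numDeriv_nonneg _ _) hK, fun ψ x => ?_⟩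
  rw [mul_assoc]
  refine derivSum_le fun n hn s => (norm_partialDeriv_le_iteratedFDeriv s _ x).trans ?_
  have h1 : ((SchwartzMap.smulLeftCLM ℂ f ψ : 𝓢(Eucl d, ℂ)) : Eucl d → ℂ) = fun y => f y * ψ y := by
    rw [SchwartzMap.smulLeftCLM_apply hf]
    rfl
  rw [h1]
  have hgS : 0 ≤ g x * derivSum m ψ x := mul_nonneg (hg x) (derivSum_nonneg _ _ _)
  calc _ ≤ ∑ i ∈ Finset.range (n + 1), (n.choose i : ℝ) * ‖iteratedFDeriv ℝ i f x‖ *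
          ‖iteratedFDeriv ℝ (n - i) ψ x‖ :=
        norm_iteratedFDeriv_mul_le hf.1 (ψ.smooth ⊤) x (by exact_mod_cast le_top)
    _ ≤ ∑ i ∈ Finset.range (n + 1), (n.choose i : ℝ) * (|C i| * g x) * derivSum m ψ x := by
        gcongr with i hi
        · exact mul_nonneg (Nat.cast_nonneg _) ((norm_nonneg _).trans (hC' i x))
        · exact hC' i x
        · exact norm_iteratedFDeriv_le_derivSum (by omega) ψ x
    _ = (∑ i ∈ Finset.range (n + 1), (n.choose i : ℝ) * |C i|) * (g x * derivSum m ψ x) := by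
        rw [Finset.sum_mul]
        exact Finset.sum_congr rfl fun i _ => by ring
    _ ≤ K * (g x * derivSum m ψ x) := by
        refine mul_le_mul_of_nonneg_right ?_ hgS
        exact Finset.single_le_sum
          (f := fun n => ∑ i ∈ Finset.range (n + 1), (n.choose i : ℝ) * |C i|)
          (fun n _ => Finset.sum_nonneg fun i _ => by positivity)
          (Finset.mem_range.2 (by omega))

/-! ### Powers of `1 + |x|²` -/

/-- The function `(1 + |x|²)^r`. -/
def japanese (r : ℝ) (x : Eucl d) : ℂ := (((1 + ‖x‖ ^ 2) ^ r : ℝ) : ℂ)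

theorem weight_eq_japanese (k : ℕ) : (weight k : Eucl d → ℂ) = japanese ((k : ℝ) / 2) := rfl

theorem japanese_hasTemperateGrowth (r : ℝ) : (japanese r : Eucl d → ℂ).HasTemperateGrowth :=
  Function.HasTemperateGrowth.comp Function.Complex.hasTemperateGrowth_ofReal
    (Function.hasTemperateGrowth_one_add_norm_sq_rpow (Eucl d) r)

theorem one_add_norm_sq_pos (x : Eucl d) : 0 < 1 + ‖x‖ ^ 2 := by positivity

theorem japanese_mul (r s : ℝ) :
    (japanese r * japanese s : Eucl d → ℂ) = japanese (r + s) := by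
  funext x
  simp only [Pi.mul_apply, japanese]
  rw [Real.rpow_add (one_add_norm_sq_pos x), Complex.ofReal_mul]

theorem japanese_zero : (japanese 0 : Eucl d → ℂ) = fun _ => 1 := by
  funext x
  simp [japanese]

/-- Order `0` gives `‖x‖`, order `1` at most `1`, and higher orders vanish; one crude bound for all
orders is what the Leibniz sum for `‖y‖²` needs. -/
theorem norm_iteratedFDeriv_id_le {E : Type*} [NormedAddCommGroup E] [NormedSpace ℝ E] (n : ℕ)
    (x : E) : ‖iteratedFDeriv ℝ n (fun y : E => y) x‖ ≤ 1 + ‖x‖ := by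
  rcases n with _ | n
  · simp
  · have : fderiv ℝ (fun y : E => y) = fun _ => ContinuousLinearMap.id ℝ E := by
      funext y
      exact fderiv_fun_id
    rw [← norm_iteratedFDeriv_fderiv, this]
    rcases n with _ | n
    · simp only [norm_iteratedFDeriv_zero]
      exact ContinuousLinearMap.norm_id_le.trans (by simp)
    · rw [iteratedFDeriv_const_of_ne (by omega)]
      simp only [Pi.zero_apply, norm_zero]
      positivity

/-- Leibniz for the bilinear inner product at `(y, y)`. The geometric constant `4 ^ n` is the shape
required by the Faà di Bruno bound used for real powers. -/
theorem norm_iteratedFDeriv_norm_sq_le {E : Type*} [NormedAddCommGroup E] [InnerProductSpace ℝ E]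
    {n : ℕ} (hn : 1 ≤ n) (x : E) :
    ‖iteratedFDeriv ℝ n (fun y : E => ‖y‖ ^ 2) x‖ ≤ 4 ^ n * (1 + ‖x‖ ^ 2) := by
  have h1 : (fun y : E => ‖y‖ ^ 2) = fun y => innerSL ℝ y y := by
    funext y
    simp
  rw [h1]
  have h2 := (innerSL ℝ (E := E)).norm_iteratedFDeriv_le_of_bilinear (f := fun y : E => y)
    (g := fun y : E => y) (N := ⊤) contDiff_id contDiff_id x (n := n) (by exact_mod_cast le_top)
  have h3 : ‖innerSL ℝ (E := E)‖ ≤ 1 :=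
    ContinuousLinearMap.opNorm_le_bound _ zero_le_one fun y => by simp
  have h4 : (1 + ‖x‖) * (1 + ‖x‖) ≤ 2 * (1 + ‖x‖ ^ 2) := by nlinarith [sq_nonneg (1 - ‖x‖)]
  calc _ ≤ _ := h2
    _ ≤ 1 * ∑ i ∈ Finset.range (n + 1), (n.choose i : ℝ) * (1 + ‖x‖) * (1 + ‖x‖) := by
        gcongr
        · exact norm_iteratedFDeriv_id_le _ _
        · exact norm_iteratedFDeriv_id_le _ _
    _ = 2 ^ n * ((1 + ‖x‖) * (1 + ‖x‖)) := by
        simp_rw [mul_assoc]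
        rw [one_mul, ← Finset.sum_mul]
        congr 1
        exact_mod_cast Nat.sum_range_choose n
    _ ≤ 2 ^ n * (2 ^ n * (1 + ‖x‖ ^ 2)) := by
        refine mul_le_mul_of_nonneg_left (h4.trans ?_) (by positivity)
        refine mul_le_mul_of_nonneg_right ?_ (by positivity)
        -- Here `1 ≤ n` matters: the factor `2` from `h4` is absorbed into `2 ^ n`.
        exact le_self_pow₀ (by norm_num) (by omega)
    _ = _ := by rw [← mul_assoc, ← mul_pow]; norm_num

/-- Normalize at the point `x`: with `c = 1 + ‖x‖²` the inner function `f = (1 + ‖y‖²)/c` takes the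
value `1` at `x` and its `i`-th derivative there is at most `4 ^ i`. The derivatives of `t ^ r` are
thus needed only at `t = 1`, so the constant does not depend on `x`; the factor `c ^ r` is the
claimed growth. -/
theorem exists_norm_iteratedFDeriv_rpow_le {E : Type*} [NormedAddCommGroup E]
    [InnerProductSpace ℝ E] (r : ℝ) (n : ℕ) : ∃ C : ℝ, ∀ x : E,
      ‖iteratedFDeriv ℝ n (fun y : E => (1 + ‖y‖ ^ 2) ^ r) x‖ ≤ C * (1 + ‖x‖ ^ 2) ^ r := by
  let g : ℝ → ℝ := fun t => t ^ r
  let K : ℝ := ∑ i ∈ Finset.range (n + 1), ‖iteratedFDerivWithin ℝ i g (Set.Ioi 0) 1‖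
  refine ⟨n.factorial * K * 4 ^ n, fun x => ?_⟩
  have hc : 0 < 1 + ‖x‖ ^ 2 := by positivity
  set c := 1 + ‖x‖ ^ 2 with hcdef
  let f : E → ℝ := fun y => c⁻¹ * (1 + ‖y‖ ^ 2)
  have hf : ContDiff ℝ ⊤ f := contDiff_const.mul (contDiff_const.add (contDiff_norm_sq ℝ))
  have hfx : f x = 1 := by simp [f, ← hcdef, hc.ne']
  have hgf : (fun y : E => (1 + ‖y‖ ^ 2) ^ r) = c ^ r • (g ∘ f) := by
    funext y
    have h1 : 0 < 1 + ‖y‖ ^ 2 := by positivity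
    simp only [Pi.smul_apply, Function.comp, g, f, smul_eq_mul]
    rw [← Real.mul_rpow hc.le (by positivity)]
    congr 1
    field_simp
  have hgd : ContDiffOn ℝ ⊤ g (Set.Ioi 0) :=
    contDiffOn_id.rpow_const_of_ne fun t ht => (Set.mem_Ioi.1 ht).ne'
  have hmaps : Set.range f ⊆ Set.Ioi 0 := by
    rintro _ ⟨y, rfl⟩
    simp only [f, Set.mem_Ioi]
    positivity
  have hcomp : ContDiff ℝ ⊤ (g ∘ f) := hgd.comp_contDiff hf fun y => hmaps ⟨y, rfl⟩
  have key := norm_iteratedFDeriv_comp_le' (n := n) (N := ⊤) (C := K) (D := 4) hmaps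
    isOpen_Ioi.uniqueDiffOn hgd hf le_top x ?_ ?_
  · rw [hgf, iteratedFDeriv_const_smul_apply (hcomp.contDiffAt.of_le le_top), norm_smul,
      Real.norm_of_nonneg (by positivity), mul_comm]
    gcongr
  · intro i hi
    rw [hfx]
    exact Finset.single_le_sum (f := fun i => ‖iteratedFDerivWithin ℝ i g (Set.Ioi 0) 1‖)
      (fun _ _ => norm_nonneg _) (Finset.mem_range.2 (by omega))
  · intro i hi _
    have h1 : f = c⁻¹ • fun y : E => 1 + ‖y‖ ^ 2 := rfl
    have h2 : iteratedFDeriv ℝ i (fun y : E => 1 + ‖y‖ ^ 2) x =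
        iteratedFDeriv ℝ i (fun y : E => ‖y‖ ^ 2) x := by
      have := iteratedFDeriv_add_apply (i := i) (x := x) (f := fun _ : E => (1 : ℝ))
        (g := fun y : E => ‖y‖ ^ 2) (𝕜 := ℝ) contDiffAt_const (contDiff_norm_sq ℝ).contDiffAt
      rw [iteratedFDeriv_const_of_ne (by omega)] at this
      simpa using! this
    rw [h1, iteratedFDeriv_const_smul_apply
      (contDiff_const.add (contDiff_norm_sq ℝ)).contDiffAt, h2, norm_smul,
      Real.norm_of_nonneg (by positivity), inv_mul_le_iff₀ hc, mul_comm]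
    exact norm_iteratedFDeriv_norm_sq_le hi x

theorem exists_norm_iteratedFDeriv_japanese_le (r : ℝ) (n : ℕ) : ∃ C : ℝ, ∀ x : Eucl d,
    ‖iteratedFDeriv ℝ n (japanese r) x‖ ≤ C * (1 + ‖x‖ ^ 2) ^ r := by
  obtain ⟨C, hC⟩ := exists_norm_iteratedFDeriv_rpow_le (E := Eucl d) r n
  refine ⟨C, fun x => ?_⟩
  have h : (japanese r : Eucl d → ℂ) = Complex.ofRealLI ∘ fun y : Eucl d => (1 + ‖y‖ ^ 2) ^ r := rfl
  rw [h, Complex.ofRealLI.norm_iteratedFDeriv_comp_left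
    (Function.hasTemperateGrowth_one_add_norm_sq_rpow (Eucl d) r).1.contDiffAt
    (by exact_mod_cast le_top)]
  exact hC x

theorem exists_derivSum_japanese_le (r : ℝ) (m : ℕ) :
    ∃ C, 0 ≤ C ∧ ∀ (ψ : 𝓢(Eucl d, ℂ)) (x : Eucl d),
      derivSum m (SchwartzMap.smulLeftCLM ℂ (japanese r) ψ) x ≤
        C * ((1 + ‖x‖ ^ 2) ^ r * derivSum m ψ x) :=
  exists_derivSum_smulLeft_le (japanese_hasTemperateGrowth r)
    (fun x => by positivity) (fun n => exists_norm_iteratedFDeriv_japanese_le r n) m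

/-! ### Reflected translates -/

theorem lineDerivOp_comm (v w : Eucl d) (f : 𝓢(Eucl d, ℂ)) :
    (∂_{v} (∂_{w} f : 𝓢(Eucl d, ℂ)) : 𝓢(Eucl d, ℂ)) = ∂_{w} (∂_{v} f : 𝓢(Eucl d, ℂ)) := by
  ext x
  have h (a b : Eucl d) : (∂_{a} (∂_{b} f : 𝓢(Eucl d, ℂ)) : 𝓢(Eucl d, ℂ)) x =
      fderiv ℝ (fderiv ℝ f) x a b := by
    have h1 : HasFDerivAt (fderiv ℝ f) (fderiv ℝ (fderiv ℝ f) x) x :=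
      (SchwartzMap.fderivCLM ℝ (Eucl d) ℂ f).hasFDerivAt x
    have h2 := congrArg (· a) (h1.clm_apply (hasFDerivAt_const b x)).fderiv
    simpa using! h2
  rw [h, h]
  exact ((f.smooth 2).contDiffAt.isSymmSndFDerivAt (by simp)) v w

theorem partialDeriv_lineDerivOp {n : ℕ} (s : Fin n → Fin d) (v : Eucl d) (f : 𝓢(Eucl d, ℂ)) :
    partialDeriv s (∂_{v} f : 𝓢(Eucl d, ℂ)) = ∂_{v} (partialDeriv s f) := by
  induction n with
  | zero => rw [partialDeriv_zero, partialDeriv_zero]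
  | succ n ih => rw [partialDeriv_succ, ih, lineDerivOp_comm, ← partialDeriv_succ]

theorem reflTranslate_add (φ ψ : 𝓢(Eucl d, ℂ)) (x : Eucl d) :
    reflTranslate (φ + ψ) x = reflTranslate φ x + reflTranslate ψ x := rfl

theorem reflTranslate_smul (c : ℂ) (φ : 𝓢(Eucl d, ℂ)) (x : Eucl d) :
    reflTranslate (c • φ) x = c • reflTranslate φ x := rfl

theorem lineDerivOp_reflTranslate (v : Eucl d) (φ : 𝓢(Eucl d, ℂ)) (x : Eucl d) :
    (∂_{v} (reflTranslate φ x) : 𝓢(Eucl d, ℂ)) = -reflTranslate (∂_{v} φ) x := by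
  ext y
  have h1 : (reflTranslate φ x : Eucl d → ℂ) = fun y => φ (x - y) :=
    funext (reflTranslate_apply φ x)
  have h2 : HasFDerivAt (fun y => φ (x - y))
      ((fderiv ℝ φ (x - y)).comp (-ContinuousLinearMap.id ℝ (Eucl d))) y :=
    (φ.hasFDerivAt (x - y)).comp y ((hasFDerivAt_id y).const_sub x)
  rw [SchwartzMap.lineDerivOp_apply_eq_fderiv, h1, h2.fderiv, neg_apply,
    reflTranslate_apply, SchwartzMap.lineDerivOp_apply_eq_fderiv]
  simp

theorem partialDeriv_reflTranslate {n : ℕ} (s : Fin n → Fin d) (φ : 𝓢(Eucl d, ℂ)) (x : Eucl d) :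
    partialDeriv s (reflTranslate φ x) = (-1 : ℂ) ^ n • reflTranslate (partialDeriv s φ) x := by
  induction n with
  | zero => simp [partialDeriv_zero]
  | succ n ih =>
    rw [partialDeriv_succ, ih, lineDerivOp_smul, lineDerivOp_reflTranslate, ← partialDeriv_succ,
      pow_succ, mul_smul, neg_one_smul]

theorem norm_partialDeriv_reflTranslate {n : ℕ} (s : Fin n → Fin d) (φ : 𝓢(Eucl d, ℂ))
    (x y : Eucl d) : ‖partialDeriv s (reflTranslate φ x) y‖ = ‖partialDeriv s φ (x - y)‖ := by
  rw [partialDeriv_reflTranslate, smul_apply, reflTranslate_apply, norm_smul]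
  simp

theorem derivSum_reflTranslate (m : ℕ) (φ : 𝓢(Eucl d, ℂ)) (x y : Eucl d) :
    derivSum m (reflTranslate φ x) y = derivSum m φ (x - y) := by
  simp only [derivSum, norm_partialDeriv_reflTranslate]

/-- A Peetre-type inequality: it trades decay in `x` for decay in `y` and in `x - y`. -/
theorem one_add_norm_le_mul (x y : Eucl d) : 1 + ‖x‖ ≤ (1 + ‖y‖) * (1 + ‖x - y‖) := by
  have h1 : ‖x‖ ≤ ‖y‖ + ‖x - y‖ := by
    simpa using norm_add_le y (x - y)
  nlinarith [norm_nonneg y, norm_nonneg (x - y)]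

theorem mu_reflTranslate_le (q m : ℕ) (φ : 𝓢(Eucl d, ℂ)) (x : Eucl d) :
    mu q m (reflTranslate φ x) ≤ (1 + ‖x‖) ^ q * mu q m φ := by
  refine mu_le fun n hn s y => ?_
  rw [norm_partialDeriv_reflTranslate]
  have h := one_add_norm_le_mul y x
  rw [norm_sub_rev] at h
  calc _ ≤ ((1 + ‖x‖) * (1 + ‖x - y‖)) ^ q * ‖partialDeriv s φ (x - y)‖ := by gcongr
    _ = (1 + ‖x‖) ^ q * ((1 + ‖x - y‖) ^ q * ‖partialDeriv s φ (x - y)‖) := by rw [mul_pow]; ring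
    _ ≤ _ := by
      gcongr
      exact le_mu hn s φ _

/-! ### Estimates for rapidly decreasing distributions -/

theorem integrable_one_add_norm_inv_pow : Integrable fun y : Eucl d => ((1 + ‖y‖) ^ (d + 1))⁻¹ := by
  have h := integrable_one_add_norm (μ := (volume : Measure (Eucl d))) (r := ((d + 1 : ℕ) : ℝ))
    (by simp)
  refine h.congr (Filter.Eventually.of_forall fun y => ?_)
  simp only
  rw [Real.rpow_neg (by positivity), Real.rpow_natCast]

/-- Spending `d + 1` further powers of the weight leaves an integrable factor on `ℝ^d`. -/
theorem pow_mul_derivSum_le (k m : ℕ) (φ : 𝓢(Eucl d, ℂ)) (y : Eucl d) :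
    (1 + ‖y‖) ^ k * derivSum m φ y ≤
      numDeriv d m * mu (k + (d + 1)) m φ * ((1 + ‖y‖) ^ (d + 1))⁻¹ := by
  rw [← div_eq_mul_inv, le_div_iff₀ (by positivity)]
  refine le_trans (le_of_eq ?_) (pow_mul_derivSum_le_mu (k + (d + 1)) m φ y)
  rw [pow_add]
  ring

/-- The estimates that define `𝓞_C'`, in terms of weighted `L¹` norms. -/
theorem exists_norm_le_integral {u : 𝓢'(Eucl d, ℂ)} (hu : u ∈ OC' d) (k : ℕ) :
    ∃ (C : ℝ) (m : ℕ), 0 ≤ C ∧ ∀ ψ : 𝓢(Eucl d, ℂ),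
      ‖u ψ‖ ≤ C * ∫ y, (1 + ‖y‖ ^ 2) ^ (-((k : ℝ) / 2)) * derivSum m ψ y := by
  obtain ⟨C, m, hC⟩ := hu k
  obtain ⟨K, hK0, hK⟩ := exists_derivSum_japanese_le (d := d) (-((k : ℝ) / 2)) m
  refine ⟨|C| * K, m, by positivity, fun ψ => ?_⟩
  -- On this test function the positive and negative weights cancel, leaving `u ψ` on the left.
  have h1 := hC (SchwartzMap.smulLeftCLM ℂ (japanese (-((k : ℝ) / 2))) ψ)
  rw [TemperedDistribution.smulLeftCLM_apply_apply, weight_eq_japanese,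
    SchwartzMap.smulLeftCLM_smulLeftCLM_apply (japanese_hasTemperateGrowth _)
      (japanese_hasTemperateGrowth _), japanese_mul, add_neg_cancel, japanese_zero,
    SchwartzMap.smulLeftCLM_const] at h1
  simp only [one_smul, ContinuousLinearMap.id_apply] at h1
  refine h1.trans ?_
  have hint : Integrable fun y : Eucl d =>
      (1 + ‖y‖ ^ 2) ^ (-((k : ℝ) / 2)) * derivSum m ψ y := by
    refine (integrable_derivSum m ψ).mono' ?_ (Filter.Eventually.of_forall fun y => ?_)
    · refine Continuous.aestronglyMeasurable (Continuous.mul ?_ ?_)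
      · exact (by fun_prop : Continuous fun y : Eucl d => 1 + ‖y‖ ^ 2).rpow_const
          fun y => Or.inl (one_add_norm_sq_pos y).ne'
      · exact continuous_finsetSum _ fun _ _ => continuous_finsetSum _ fun s _ =>
          (partialDeriv s ψ).continuous.norm
    · rw [Real.norm_of_nonneg (mul_nonneg (by positivity) (derivSum_nonneg _ _ _))]
      refine mul_le_of_le_one_left (derivSum_nonneg _ _ _) ?_
      exact Real.rpow_le_one_of_one_le_of_nonpos (by nlinarith [sq_nonneg ‖y‖])
        (by simp only [Left.neg_nonpos_iff]; positivity)
  calc _ ≤ |C| * sobolevL1 m (SchwartzMap.smulLeftCLM ℂ (japanese (-((k : ℝ) / 2))) ψ) :=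
        mul_le_mul_of_nonneg_right (le_abs_self C) (sobolevL1_nonneg _ _)
    _ ≤ |C| * ∫ y, K * ((1 + ‖y‖ ^ 2) ^ (-((k : ℝ) / 2)) * derivSum m ψ y) := by
        rw [sobolevL1_eq_integral]
        gcongr
        · exact integrable_derivSum _ _
        · exact hint.const_mul K
        · exact fun y => hK ψ y
    _ = _ := by rw [integral_const_mul, mul_assoc]

/-- Continuity of `u` by a single seminorm, from the case `k = 0`; it serves both the
differentiation of `u * φ` and the Banach space factorization. -/
theorem exists_norm_le_mu {u : 𝓢'(Eucl d, ℂ)} (hu : u ∈ OC' d) :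
    ∃ (C : ℝ) (q m : ℕ), 0 ≤ C ∧ ∀ ψ : 𝓢(Eucl d, ℂ), ‖u ψ‖ ≤ C * mu q m ψ := by
  obtain ⟨C, m, hC0, hC⟩ := exists_norm_le_integral hu 0
  refine ⟨C * (numDeriv d m * ∫ y : Eucl d, ((1 + ‖y‖) ^ (d + 1))⁻¹), d + 1, m,
    mul_nonneg hC0 (mul_nonneg (numDeriv_nonneg _ _) (integral_nonneg fun _ => by positivity)),
    fun ψ => (hC ψ).trans ?_⟩
  rw [mul_assoc]
  gcongr
  calc _ ≤ ∫ y : Eucl d, numDeriv d m * mu (d + 1) m ψ * ((1 + ‖y‖) ^ (d + 1))⁻¹ := by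
        refine integral_mono_of_nonneg (Filter.Eventually.of_forall fun y =>
          mul_nonneg (by positivity) (derivSum_nonneg _ _ _))
          (integrable_one_add_norm_inv_pow.const_mul _) (Filter.Eventually.of_forall fun y => ?_)
        simpa using pow_mul_derivSum_le 0 m ψ y
    _ = _ := by
        rw [integral_const_mul]
        ring

/-- The convolution of a rapidly decreasing distribution with a Schwartz function decreases
rapidly, with an estimate that is uniform in the Schwartz function. -/
theorem exists_pow_mul_norm_conv_le {u : 𝓢'(Eucl d, ℂ)} (hu : u ∈ OC' d) (k : ℕ) :
    ∃ (C : ℝ) (q m : ℕ), 0 ≤ C ∧ ∀ (φ : 𝓢(Eucl d, ℂ)) (x : Eucl d),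
      (1 + ‖x‖) ^ k * ‖conv u φ x‖ ≤ C * mu q m φ := by
  -- The choice `2 * k` makes the weight `(1 + ‖y‖²)^(-k)`, which absorbs `(1 + ‖y‖)^k` since `1 +
  -- ‖y‖ ≤ 2(1 + ‖y‖²)`.
  obtain ⟨C, m, hC0, hC⟩ := exists_norm_le_integral hu (2 * k)
  refine ⟨C * (2 ^ k * numDeriv d m * ∫ y : Eucl d, ((1 + ‖y‖) ^ (d + 1))⁻¹), k + (d + 1), m,
    mul_nonneg hC0 (mul_nonneg (mul_nonneg (by positivity) (numDeriv_nonneg _ _))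
      (integral_nonneg fun _ => by positivity)), fun φ x => ?_⟩
  calc _ ≤ (1 + ‖x‖) ^ k * (C * ∫ y : Eucl d, (1 + ‖y‖ ^ 2) ^ (-(((2 * k : ℕ) : ℝ) / 2)) *
          derivSum m (reflTranslate φ x) y) := by
        gcongr
        exact hC (reflTranslate φ x)
    _ = C * ∫ y : Eucl d, (1 + ‖x‖) ^ k * ((1 + ‖y‖ ^ 2) ^ (-(((2 * k : ℕ) : ℝ) / 2)) *
          derivSum m φ (x - y)) := by
        rw [integral_const_mul, mul_left_comm]
        simp_rw [derivSum_reflTranslate]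
    _ ≤ C * ∫ y : Eucl d, 2 ^ k * (numDeriv d m * mu (k + (d + 1)) m φ) *
          ((1 + ‖x - y‖) ^ (d + 1))⁻¹ := by
        refine mul_le_mul_of_nonneg_left ?_ hC0
        refine integral_mono_of_nonneg (Filter.Eventually.of_forall fun y =>
          mul_nonneg (by positivity) (mul_nonneg (by positivity) (derivSum_nonneg _ _ _)))
          ((integrable_one_add_norm_inv_pow.comp_sub_left x).const_mul _)
          (Filter.Eventually.of_forall fun y => ?_)
        have h1 : ((1 : ℝ) + ‖y‖ ^ 2) ^ (-(((2 * k : ℕ) : ℝ) / 2)) = ((1 + ‖y‖ ^ 2) ^ k)⁻¹ := by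
          rw [Real.rpow_neg (by positivity), ← Real.rpow_natCast (1 + ‖y‖ ^ 2) k]
          congr 2
          push_cast
          ring
        simp only
        rw [h1]
        have h2 : (1 + ‖x‖) ^ k ≤ 2 ^ k * (1 + ‖y‖ ^ 2) ^ k * (1 + ‖x - y‖) ^ k := by
          rw [← mul_pow, ← mul_pow]
          refine pow_le_pow_left₀ (by positivity) ((one_add_norm_le_mul x y).trans ?_) k
          gcongr
          nlinarith [sq_nonneg (‖y‖ - 1), sq_nonneg ‖y‖]
        calc _ ≤ (2 ^ k * (1 + ‖y‖ ^ 2) ^ k * (1 + ‖x - y‖) ^ k) *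
              (((1 + ‖y‖ ^ 2) ^ k)⁻¹ * derivSum m φ (x - y)) :=
              mul_le_mul_of_nonneg_right h2
                (mul_nonneg (by positivity) (derivSum_nonneg _ _ _))
          _ = 2 ^ k * ((1 + ‖x - y‖) ^ k * derivSum m φ (x - y)) := by
              field_simp
          _ ≤ _ := by
              rw [mul_assoc ((2 : ℝ) ^ k)]
              exact mul_le_mul_of_nonneg_left (pow_mul_derivSum_le k m φ (x - y)) (by positivity)
    _ = _ := by
        rw [integral_const_mul,
          integral_sub_left_eq_self (fun y : Eucl d => ((1 + ‖y‖) ^ (d + 1))⁻¹) volume x]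
        ring

/-- `𝓞_C'` is stable under partial derivatives. -/
theorem lineDerivOp_mem_OC' {u : 𝓢'(Eucl d, ℂ)} (hu : u ∈ OC' d) (j : Fin d) :
    (∂_{e j} u : 𝓢'(Eucl d, ℂ)) ∈ OC' d := by
  intro k
  obtain ⟨C, m, hC0, hC⟩ := exists_norm_le_integral hu k
  obtain ⟨K, hK0, hK⟩ := exists_derivSum_japanese_le (d := d) ((k : ℝ) / 2) (m + 1)
  refine ⟨C * (numDeriv d m * K), m + 1, fun φ => ?_⟩
  rw [TemperedDistribution.smulLeftCLM_apply_apply, TemperedDistribution.lineDerivOp_apply_apply,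
    map_neg, norm_neg, weight_eq_japanese]
  refine (hC _).trans ?_
  rw [mul_assoc, sobolevL1_eq_integral, ← integral_const_mul (numDeriv d m * K)]
  refine mul_le_mul_of_nonneg_left ?_ hC0
  refine integral_mono_of_nonneg (Filter.Eventually.of_forall fun y =>
    mul_nonneg (by positivity) (derivSum_nonneg _ _ _))
    ((integrable_derivSum (m + 1) φ).const_mul _) (Filter.Eventually.of_forall fun y => ?_)
  have h0 : (0 : ℝ) < (1 + ‖y‖ ^ 2) ^ ((k : ℝ) / 2) := by positivity
  -- The derivative lands on the weighted test function: it costs one order, and the weight that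
  -- appears cancels the negative one in `hC`.
  have h1 : derivSum m (∂_{e j} (SchwartzMap.smulLeftCLM ℂ (japanese ((k : ℝ) / 2)) φ) :
      𝓢(Eucl d, ℂ)) y ≤
        numDeriv d m * (K * ((1 + ‖y‖ ^ 2) ^ ((k : ℝ) / 2) * derivSum (m + 1) φ y)) := by
    refine derivSum_le fun n hn s => ?_
    rw [← partialDeriv_snoc]
    exact (norm_partialDeriv_le_derivSum (by omega) _ _ _).trans (hK φ y)
  simp only
  rw [Real.rpow_neg (by positivity), inv_mul_le_iff₀ h0]
  refine h1.trans (le_of_eq ?_)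
  ring

/-! ### Differentiability of translations -/

theorem exists_pow_mul_norm_le {F : Type*} [NormedAddCommGroup F] [NormedSpace ℝ F] (q : ℕ)
    (g : 𝓢(Eucl d, F)) : ∃ C, 0 ≤ C ∧ ∀ x, (1 + ‖x‖) ^ q * ‖g x‖ ≤ C := by
  refine ⟨2 ^ q * (Finset.Iic (q, 0)).sup (fun m => SchwartzMap.seminorm ℝ m.1 m.2) g,
    by positivity, fun x => ?_⟩
  simpa using SchwartzMap.one_add_le_sup_seminorm_apply (𝕜 := ℝ) (m := (q, 0)) le_rfl le_rfl g x

/-- Mean value inequality on a ball of radius at most `1`, where the weights at `y` and `z` agree up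
to a factor `2 ^ q`. A general target `F` allows the result to be applied to the derivative of a
Schwartz function. -/
theorem exists_norm_sub_le {F : Type*} [NormedAddCommGroup F] [NormedSpace ℝ F] (q : ℕ)
    (g : 𝓢(Eucl d, F)) : ∃ C, 0 ≤ C ∧ ∀ y h : Eucl d, ‖h‖ ≤ 1 →
      (1 + ‖y‖) ^ q * ‖g (y + h) - g y‖ ≤ C * ‖h‖ := by
  obtain ⟨C, hC0, hC⟩ := exists_pow_mul_norm_le q (SchwartzMap.fderivCLM ℝ (Eucl d) F g)
  refine ⟨2 ^ q * C, by positivity, fun y h hh => ?_⟩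
  have hy : (0 : ℝ) < (1 + ‖y‖) ^ q := by positivity
  have key := (convex_closedBall y ‖h‖).norm_image_sub_le_of_norm_hasFDerivWithin_le
    (f := g) (C := 2 ^ q * C * ((1 + ‖y‖) ^ q)⁻¹) (x := y) (y := y + h)
    (fun z _ => (g.hasFDerivAt z).hasFDerivWithinAt) (fun z hz => ?_)
    (Metric.mem_closedBall_self (norm_nonneg _)) (by simp)
  · rw [add_sub_cancel_left] at key
    calc _ ≤ (1 + ‖y‖) ^ q * (2 ^ q * C * ((1 + ‖y‖) ^ q)⁻¹ * ‖h‖) := by gcongr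
      _ = _ := by field_simp
  · rw [← div_eq_mul_inv, le_div_iff₀ hy]
    have hz1 : ‖y - z‖ ≤ 1 := by
      rw [norm_sub_rev]
      exact (mem_closedBall_iff_norm.1 hz).trans hh
    have h1 : 1 + ‖y‖ ≤ 2 * (1 + ‖z‖) := by
      have := norm_add_le z (y - z)
      rw [add_sub_cancel] at this
      linarith [norm_nonneg z]
    calc ‖fderiv ℝ g z‖ * (1 + ‖y‖) ^ q ≤ ‖fderiv ℝ g z‖ * (2 * (1 + ‖z‖)) ^ q := by gcongr
      _ = 2 ^ q * ((1 + ‖z‖) ^ q * ‖fderiv ℝ g z‖) := by rw [mul_pow]; ring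
      _ ≤ _ := by
        gcongr
        exact hC z

/-- The mean value inequality applied to `g` minus its linearization at `y`, whose derivative is
`O(‖h‖)` on the ball by `exists_norm_sub_le`. -/
theorem exists_norm_sub_sub_le {F : Type*} [NormedAddCommGroup F] [NormedSpace ℝ F] (q : ℕ)
    (g : 𝓢(Eucl d, F)) : ∃ C, 0 ≤ C ∧ ∀ y h : Eucl d, ‖h‖ ≤ 1 →
      (1 + ‖y‖) ^ q * ‖g (y + h) - g y - fderiv ℝ g y h‖ ≤ C * ‖h‖ ^ 2 := by
  obtain ⟨C, hC0, hC⟩ := exists_norm_sub_le q (SchwartzMap.fderivCLM ℝ (Eucl d) F g)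
  refine ⟨C, hC0, fun y h hh => ?_⟩
  have hy : (0 : ℝ) < (1 + ‖y‖) ^ q := by positivity
  have key := (convex_closedBall y ‖h‖).norm_image_sub_le_of_norm_hasFDerivWithin_le'
    (f := g) (φ := fderiv ℝ g y) (C := C * ‖h‖ * ((1 + ‖y‖) ^ q)⁻¹) (x := y) (y := y + h)
    (fun z _ => (g.hasFDerivAt z).hasFDerivWithinAt) (fun z hz => ?_)
    (Metric.mem_closedBall_self (norm_nonneg _)) (by simp)
  · rw [add_sub_cancel_left] at key
    calc _ ≤ (1 + ‖y‖) ^ q * (C * ‖h‖ * ((1 + ‖y‖) ^ q)⁻¹ * ‖h‖) := by gcongr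
      _ = _ := by field_simp
  · rw [← div_eq_mul_inv, le_div_iff₀ hy, mul_comm]
    have hz1 : ‖z - y‖ ≤ ‖h‖ := mem_closedBall_iff_norm.1 hz
    have := hC y (z - y) (hz1.trans hh)
    rw [add_sub_cancel] at this
    exact this.trans (by gcongr)

/-- A bound for `μ_{q,m}` of a Schwartz function whose partial derivatives are bounded by
reflected translates. -/
theorem mu_le_of_reflected {q m : ℕ} {ψ : 𝓢(Eucl d, ℂ)} {x : Eucl d} {B : ℝ}
    (h : ∀ n ≤ m, ∀ (s : Fin n → Fin d) (y : Eucl d),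
      (1 + ‖x - y‖) ^ q * ‖partialDeriv s ψ y‖ ≤ B) :
    mu q m ψ ≤ (1 + ‖x‖) ^ q * B := by
  refine mu_le fun n hn s y => ?_
  have h1 := one_add_norm_le_mul y x
  rw [norm_sub_rev] at h1
  calc _ ≤ ((1 + ‖x‖) * (1 + ‖x - y‖)) ^ q * ‖partialDeriv s ψ y‖ := by gcongr
    _ = (1 + ‖x‖) ^ q * ((1 + ‖x - y‖) ^ q * ‖partialDeriv s ψ y‖) := by rw [mul_pow]; ring
    _ ≤ _ := by
      gcongr
      exact h n hn s y

/-- Only finitely many sequences have length at most `m`, so the sum of their constants works for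
all. -/
theorem exists_forall_sequence_le {m : ℕ} {P : (n : ℕ) → (Fin n → Fin d) → ℝ → Prop}
    (hmono : ∀ n s a b, a ≤ b → P n s a → P n s b) (h : ∀ n s, ∃ C, 0 ≤ C ∧ P n s C) :
    ∃ C, 0 ≤ C ∧ ∀ n ≤ m, ∀ s, P n s C := by
  choose C hC0 hC using h
  refine ⟨∑ n ∈ Finset.range (m + 1), ∑ s : Fin n → Fin d, C n s,
    Finset.sum_nonneg fun n _ => Finset.sum_nonneg fun s _ => hC0 n s, fun n hn s =>
    hmono n s _ _ ?_ (hC n s)⟩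
  exact (Finset.single_le_sum (f := fun s => C n s) (fun s _ => hC0 n s)
    (Finset.mem_univ s)).trans (Finset.single_le_sum (f := fun n => ∑ s : Fin n → Fin d, C n s)
      (fun n _ => Finset.sum_nonneg fun s _ => hC0 n s) (Finset.mem_range.2 (by omega)))

theorem partialDeriv_sub {n : ℕ} (s : Fin n → Fin d) (f g : 𝓢(Eucl d, ℂ)) :
    partialDeriv s (f - g) = partialDeriv s f - partialDeriv s g := by
  simp only [← partialDerivCLM_apply, map_sub]

theorem exists_mu_reflTranslate_sub_le (q m : ℕ) (φ : 𝓢(Eucl d, ℂ)) :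
    ∃ C, 0 ≤ C ∧ ∀ x h : Eucl d, ‖h‖ ≤ 1 →
      mu q m (reflTranslate φ (x + h) - reflTranslate φ x) ≤ (1 + ‖x‖) ^ q * (C * ‖h‖) := by
  obtain ⟨C, hC0, hC⟩ := exists_forall_sequence_le (m := m)
    (P := fun n (s : Fin n → Fin d) C => ∀ y h : Eucl d, ‖h‖ ≤ 1 →
      (1 + ‖y‖) ^ q * ‖partialDeriv s φ (y + h) - partialDeriv s φ y‖ ≤ C * ‖h‖)
    (fun n s a b hab H y h hh => (H y h hh).trans (by gcongr))
    fun n s => exists_norm_sub_le q (partialDeriv s φ)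
  refine ⟨C, hC0, fun x h hh => mu_le_of_reflected fun n hn s y => ?_⟩
  have := hC n hn s (x - y) h hh
  rw [partialDeriv_sub, partialDeriv_reflTranslate, partialDeriv_reflTranslate, ← smul_sub,
    smul_apply, sub_apply, reflTranslate_apply, reflTranslate_apply,
    norm_smul, norm_pow, norm_neg, norm_one, one_pow, one_mul, add_sub_right_comm]
  exact this

theorem exists_mu_reflTranslate_sub_sub_le (q m : ℕ) (φ : 𝓢(Eucl d, ℂ)) :
    ∃ C, 0 ≤ C ∧ ∀ x h : Eucl d, ‖h‖ ≤ 1 →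
      mu q m (reflTranslate φ (x + h) - reflTranslate φ x - reflTranslate (∂_{h} φ) x) ≤
        (1 + ‖x‖) ^ q * (C * ‖h‖ ^ 2) := by
  obtain ⟨C, hC0, hC⟩ := exists_forall_sequence_le (m := m)
    (P := fun n (s : Fin n → Fin d) C => ∀ y h : Eucl d, ‖h‖ ≤ 1 →
      (1 + ‖y‖) ^ q * ‖partialDeriv s φ (y + h) - partialDeriv s φ y -
        fderiv ℝ (partialDeriv s φ) y h‖ ≤ C * ‖h‖ ^ 2)
    (fun n s a b hab H y h hh => (H y h hh).trans (by gcongr))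
    fun n s => exists_norm_sub_sub_le q (partialDeriv s φ)
  refine ⟨C, hC0, fun x h hh => mu_le_of_reflected fun n hn s y => ?_⟩
  have := hC n hn s (x - y) h hh
  rw [partialDeriv_sub, partialDeriv_sub, partialDeriv_reflTranslate, partialDeriv_reflTranslate,
    partialDeriv_reflTranslate, ← smul_sub, ← smul_sub, smul_apply,
    sub_apply, sub_apply, reflTranslate_apply, reflTranslate_apply,
    reflTranslate_apply, partialDeriv_lineDerivOp, SchwartzMap.lineDerivOp_apply_eq_fderiv,
    norm_smul, norm_pow, norm_neg, norm_one, one_pow, one_mul, add_sub_right_comm]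
  exact this

/-! ### The convolution is a Schwartz function -/

/-- The derivative of `u * φ` at `x`. -/
def convFDeriv (u : 𝓢'(Eucl d, ℂ)) (φ : 𝓢(Eucl d, ℂ)) (x : Eucl d) : Eucl d →L[ℝ] ℂ :=
  LinearMap.toContinuousLinearMap
    { toFun := fun h => conv u (∂_{h} φ) x
      map_add' := fun v w => by
        rw [lineDerivOp_left_add, conv, reflTranslate_add, map_add]
        rfl
      map_smul' := fun c v => by
        have : (∂_{c • v} φ : 𝓢(Eucl d, ℂ)) = (c : ℂ) • (∂_{v} φ : 𝓢(Eucl d, ℂ)) := by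
          rw [lineDerivOp_left_smul]
          rfl
        rw [this, conv, reflTranslate_smul, map_smul]
        rfl }

theorem convFDeriv_apply (u : 𝓢'(Eucl d, ℂ)) (φ : 𝓢(Eucl d, ℂ)) (x h : Eucl d) :
    convFDeriv u φ x h = conv u (∂_{h} φ) x := rfl

/-- The Taylor remainder of `x ↦ φ(x - ·)` is `O(‖h‖²)` in each `μ_{q,m}`, and `u` is bounded by one
of these. -/
theorem hasFDerivAt_conv {u : 𝓢'(Eucl d, ℂ)} (hu : u ∈ OC' d) (φ : 𝓢(Eucl d, ℂ)) (x : Eucl d) :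
    HasFDerivAt (conv u φ) (convFDeriv u φ x) x := by
  obtain ⟨C, q, m, hC0, hC⟩ := exists_norm_le_mu hu
  obtain ⟨K, hK0, hK⟩ := exists_mu_reflTranslate_sub_sub_le q m φ
  rw [hasFDerivAt_iff_isLittleO_nhds_zero]
  have h1 : (fun h : Eucl d => conv u φ (x + h) - conv u φ x - convFDeriv u φ x h) =O[𝓝 0]
      fun h => ‖h‖ ^ 2 := by
    refine Asymptotics.IsBigO.of_bound (C * ((1 + ‖x‖) ^ q * K)) ?_
    filter_upwards [Metric.closedBall_mem_nhds (0 : Eucl d) one_pos] with h hh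
    have hh' : ‖h‖ ≤ 1 := by simpa using hh
    have h2 : conv u φ (x + h) - conv u φ x - convFDeriv u φ x h =
        u (reflTranslate φ (x + h) - reflTranslate φ x - reflTranslate (∂_{h} φ) x) := by
      rw [map_sub, map_sub]
      rfl
    rw [h2, Real.norm_of_nonneg (by positivity)]
    calc _ ≤ _ := hC _
      _ ≤ C * ((1 + ‖x‖) ^ q * (K * ‖h‖ ^ 2)) := by
        gcongr
        exact hK x h hh'
      _ = _ := by ring
  exact h1.trans_isLittleO (Asymptotics.isLittleO_norm_pow_id one_lt_two)

theorem contDiff_conv {u : 𝓢'(Eucl d, ℂ)} (hu : u ∈ OC' d) (φ : 𝓢(Eucl d, ℂ)) (n : ℕ) :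
    ContDiff ℝ n (conv u φ) := by
  induction n generalizing φ with
  | zero =>
    exact contDiff_zero.2 (continuous_iff_continuousAt.2 fun x =>
      (hasFDerivAt_conv hu φ x).continuousAt)
  | succ n ih =>
    push_cast
    refine contDiff_succ_iff_fderiv_apply.2
      ⟨fun x => (hasFDerivAt_conv hu φ x).differentiableAt, by simp, fun h => ?_⟩
    simp_rw [(hasFDerivAt_conv hu φ _).fderiv]
    exact ih (∂_{h} φ)

theorem contDiff_infty_conv {u : 𝓢'(Eucl d, ℂ)} (hu : u ∈ OC' d) (φ : 𝓢(Eucl d, ℂ)) :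
    ContDiff ℝ (⊤ : ℕ∞) (conv u φ) :=
  contDiff_infty.2 fun n => contDiff_conv hu φ n

theorem iteratedFDeriv_conv {u : 𝓢'(Eucl d, ℂ)} (hu : u ∈ OC' d) (φ : 𝓢(Eucl d, ℂ)) {n : ℕ}
    (s : Fin n → Fin d) (x : Eucl d) :
    iteratedFDeriv ℝ n (conv u φ) x (fun i => e (s i)) = conv u (partialDeriv s φ) x := by
  induction n generalizing x with
  | zero => simp [partialDeriv_zero]
  | succ n ih =>
    rw [iteratedFDeriv_succ_apply_left, ← fderiv_continuousMultilinear_apply_const_apply]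
    · have h : (fun y => iteratedFDeriv ℝ n (conv u φ) y (Fin.tail fun i => e (s i))) =
          conv u (partialDeriv (Fin.tail s) φ) := funext fun y => ih (Fin.tail s) y
      rw [h, (hasFDerivAt_conv hu _ x).fderiv, convFDeriv_apply, partialDeriv_succ]
    · exact (contDiff_infty_conv hu φ).differentiable_iteratedFDeriv
        (mod_cast ENat.natCast_lt_top n) x

theorem mu_partialDeriv_le (q m : ℕ) {n : ℕ} (s : Fin n → Fin d) (φ : 𝓢(Eucl d, ℂ)) :
    mu q m (partialDeriv s φ) ≤ mu q (m + n) φ := by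
  induction n generalizing φ m with
  | zero => rw [partialDeriv_zero, add_zero]
  | succ n ih =>
    rw [partialDeriv_succ]
    refine (mu_lineDeriv_le _ _ _ _).trans ((ih (m + 1) _ φ).trans ?_)
    rw [Nat.add_right_comm, Nat.add_assoc]

/-- The convolution of a rapidly decreasing distribution and a Schwartz function, as a Schwartz
function. -/
def convSchwartz (u : OC' d) (φ : 𝓢(Eucl d, ℂ)) : 𝓢(Eucl d, ℂ) where
  toFun := conv u.1 φ
  smooth' := contDiff_infty_conv u.2 φ
  decay' k n := by
    obtain ⟨C, q, m, hC0, hC⟩ := exists_pow_mul_norm_conv_le u.2 k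
    refine ⟨∑ _s : Fin n → Fin d, C * mu q (m + n) φ, fun x => ?_⟩
    calc _ ≤ (1 + ‖x‖) ^ k * ∑ s : Fin n → Fin d,
            ‖iteratedFDeriv ℝ n (conv u.1 φ) x fun i => e (s i)‖ := by
          gcongr
          · linarith
          · exact norm_multilinear_le_sum_basis _
      _ ≤ _ := by
          rw [Finset.mul_sum]
          refine Finset.sum_le_sum fun s _ => ?_
          rw [iteratedFDeriv_conv u.2]
          refine (hC _ x).trans ?_
          gcongr
          exact mu_partialDeriv_le q m s φ

theorem convSchwartz_apply (u : OC' d) (φ : 𝓢(Eucl d, ℂ)) (x : Eucl d) :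
    convSchwartz u φ x = conv u.1 φ x := rfl

theorem partialDeriv_convSchwartz (u : OC' d) (φ : 𝓢(Eucl d, ℂ)) {n : ℕ} (s : Fin n → Fin d) :
    partialDeriv s (convSchwartz u φ) = convSchwartz u (partialDeriv s φ) := by
  ext x
  rw [partialDeriv_apply]
  exact iteratedFDeriv_conv u.2 φ s x

/-- Derivatives of `u * φ` fall on `φ`, so the decay estimate bounds every seminorm; uniformity in
`φ` is what gives moderateness. -/
theorem exists_mu_convSchwartz_le (u : OC' d) (q l : ℕ) :
    ∃ (C : ℝ) (q' l' : ℕ), 0 ≤ C ∧ ∀ φ : 𝓢(Eucl d, ℂ),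
      mu q l (convSchwartz u φ) ≤ C * mu q' l' φ := by
  obtain ⟨C, q', m, hC0, hC⟩ := exists_pow_mul_norm_conv_le u.2 q
  refine ⟨C, q', m + l, hC0, fun φ => mu_le fun n hn s x => ?_⟩
  rw [partialDeriv_convSchwartz]
  refine (hC _ x).trans ?_
  gcongr
  refine (mu_partialDeriv_le q' m s φ).trans (mu_le fun n' hn' s' y => ?_)
  exact le_mu (by omega) s' φ y

/-- The minus sign in the definition of `∂_j u` cancels the one from differentiating `φ(x - y)` in
`y`. -/
theorem convSchwartz_lineDerivOp (u : OC' d) (j : Fin d)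
    (h : (∂_{e j} u.1 : 𝓢'(Eucl d, ℂ)) ∈ OC' d) (φ : 𝓢(Eucl d, ℂ)) :
    convSchwartz ⟨_, h⟩ φ = ∂_{e j} (convSchwartz u φ) := by
  ext x
  rw [SchwartzMap.lineDerivOp_apply_eq_fderiv]
  have h1 : fderiv ℝ (convSchwartz u φ) x = convFDeriv u.1 φ x := (hasFDerivAt_conv u.2 φ x).fderiv
  rw [h1, convFDeriv_apply, convSchwartz_apply, conv, TemperedDistribution.lineDerivOp_apply_apply,
    lineDerivOp_reflTranslate, neg_neg]
  rfl

/-! ### Factorization through a Banach space -/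

/-- The Banach space of finite families of bounded continuous functions, indexed by the partial
derivatives of order at most `m`. -/
abbrev BddFamily (d m : ℕ) : Type :=
  (Σ n : Fin (m + 1), (Fin n → Fin d)) → BoundedContinuousFunction (Eucl d) ℂ

/-- The map `f ↦ ((1 + |x|²)^q ∂^α f)_{|α| ≤ m}`. -/
def toBddFamily (q m : ℕ) : 𝓢(Eucl d, ℂ) →L[ℂ] BddFamily d m :=
  ContinuousLinearMap.pi fun i =>
    (SchwartzMap.toBoundedContinuousFunctionCLM ℂ (Eucl d) ℂ).comp
      ((SchwartzMap.smulLeftCLM ℂ (japanese (q : ℝ))).comp (partialDerivCLM i.2))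

theorem toBddFamily_apply (q m : ℕ) (f : 𝓢(Eucl d, ℂ))
    (i : Σ n : Fin (m + 1), (Fin n → Fin d)) (y : Eucl d) :
    toBddFamily q m f i y = japanese (q : ℝ) y * partialDeriv i.2 f y := by
  have h : toBddFamily q m f i y =
      SchwartzMap.smulLeftCLM ℂ (japanese (q : ℝ)) (partialDerivCLM i.2 f) y := rfl
  rw [h, SchwartzMap.smulLeftCLM_apply_apply (japanese_hasTemperateGrowth _),
    partialDerivCLM_apply, smul_eq_mul]

theorem norm_japanese_natCast (q : ℕ) (y : Eucl d) :
    ‖japanese (q : ℝ) y‖ = (1 + ‖y‖ ^ 2) ^ q := by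
  rw [japanese, Complex.norm_real, Real.rpow_natCast, Real.norm_of_nonneg (by positivity)]

theorem norm_toBddFamily_le (q m : ℕ) (f : 𝓢(Eucl d, ℂ)) :
    ‖toBddFamily q m f‖ ≤ mu (2 * q) m f := by
  refine (pi_norm_le_iff_of_nonneg (mu_nonneg _ _ _)).2 fun i =>
    (BoundedContinuousFunction.norm_le (mu_nonneg _ _ _)).2 fun y => ?_
  rw [toBddFamily_apply, norm_mul, norm_japanese_natCast]
  refine le_trans ?_ (le_mu (q := 2 * q) (by have := i.1.2; omega) i.2 f y)
  rw [pow_mul]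
  gcongr
  nlinarith [norm_nonneg y]

theorem mu_le_norm_toBddFamily (q m : ℕ) (f : 𝓢(Eucl d, ℂ)) :
    mu q m f ≤ 2 ^ q * ‖toBddFamily q m f‖ := by
  refine mu_le fun n hn s y => ?_
  have h := ((toBddFamily q m f ⟨⟨n, by omega⟩, s⟩).norm_coe_le_norm y).trans
    (norm_le_pi_norm (toBddFamily q m f) ⟨⟨n, by omega⟩, s⟩)
  rw [toBddFamily_apply, norm_mul, norm_japanese_natCast] at h
  calc _ ≤ (2 * (1 + ‖y‖ ^ 2)) ^ q * ‖partialDeriv s f y‖ := by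
        gcongr
        nlinarith [sq_nonneg (‖y‖ - 1), sq_nonneg ‖y‖]
    _ = 2 ^ q * ((1 + ‖y‖ ^ 2) ^ q * ‖partialDeriv s f y‖) := by rw [mul_pow, mul_assoc]
    _ ≤ _ := by gcongr

theorem eq_zero_of_mu_le {q m : ℕ} {f : 𝓢(Eucl d, ℂ)} (h : mu q m f ≤ 0) : f = 0 := by
  ext x
  have h1 := (le_mu (q := q) (Nat.zero_le m) (fun i => i.elim0) f x).trans h
  rw [partialDeriv_zero] at h1
  have h2 : (0 : ℝ) < (1 + ‖x‖) ^ q := by positivity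
  simpa using nonpos_of_mul_nonpos_right h1 h2

theorem toBddFamily_injective (q m : ℕ) :
    Function.Injective (toBddFamily q m : 𝓢(Eucl d, ℂ) →L[ℂ] BddFamily d m) := by
  refine (injective_iff_map_eq_zero _).2 fun f hf => eq_zero_of_mu_le (q := q) (m := m) ?_
  simpa [hf] using mu_le_norm_toBddFamily q m f

/-- Since `toBddFamily` is injective and its norm dominates `μ_{q,m}`, `u` becomes a bounded
functional on the range, which Hahn–Banach extends. -/
theorem exists_eq_comp_toBddFamily {u : 𝓢'(Eucl d, ℂ)} (hu : u ∈ OC' d) :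
    ∃ (q m : ℕ) (U : BddFamily d m →L[ℂ] ℂ), ∀ f, u f = U (toBddFamily q m f) := by
  obtain ⟨C, q, m, hC0, hC⟩ := exists_norm_le_mu hu
  let E := LinearEquiv.ofInjective (toBddFamily (d := d) q m).toLinearMap
    (toBddFamily_injective q m)
  let v : 𝓢(Eucl d, ℂ) →ₗ[ℂ] ℂ :=
    { toFun := fun f => u f
      map_add' := fun f g => map_add u f g
      map_smul' := fun c f => map_smul u c f }
  let V := (v.comp E.symm.toLinearMap).mkContinuous (C * 2 ^ q) fun g => by
    obtain ⟨f, rfl⟩ := E.surjective g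
    simp only [LinearMap.comp_apply, LinearEquiv.coe_coe, LinearEquiv.symm_apply_apply]
    calc ‖u f‖ ≤ C * mu q m f := hC f
      _ ≤ C * (2 ^ q * ‖toBddFamily q m f‖) := by
        gcongr
        exact mu_le_norm_toBddFamily q m f
      _ = _ := (mul_assoc _ _ _).symm
  obtain ⟨U, hU, -⟩ := exists_extension_norm_eq _ V
  refine ⟨q, m, U, fun f => ?_⟩
  have h1 : U (toBddFamily q m f) = V (E f) := hU (E f)
  rw [h1]
  change u f = u (E.symm (E f))
  rw [LinearEquiv.symm_apply_apply]

/-! ### The two orders of convolution agree -/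

theorem continuous_toBddFamily_reflTranslate (q m : ℕ) (φ : 𝓢(Eucl d, ℂ)) :
    Continuous fun x => toBddFamily q m (reflTranslate φ x) := by
  obtain ⟨C, hC0, hC⟩ := exists_mu_reflTranslate_sub_le (2 * q) m φ
  refine continuous_iff_continuousAt.2 fun x => ?_
  refine continuousAt_of_locally_lipschitz one_pos ((1 + ‖x‖) ^ (2 * q) * C) fun y hy => ?_
  have h := hC x (y - x) (by rw [← dist_eq_norm]; exact hy.le)
  rw [add_sub_cancel] at h
  rw [dist_eq_norm, dist_eq_norm, ← map_sub, mul_assoc]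
  exact (norm_toBddFamily_le _ _ _).trans h

theorem integrable_pow_mul_norm {F : Type*} [NormedAddCommGroup F] [NormedSpace ℝ F] (q : ℕ)
    (g : 𝓢(Eucl d, F)) : Integrable fun x => (1 + ‖x‖) ^ q * ‖g x‖ := by
  obtain ⟨C, hC0, hC⟩ := exists_pow_mul_norm_le (q + (d + 1)) g
  refine (integrable_one_add_norm_inv_pow.const_mul C).mono'
    (Continuous.aestronglyMeasurable (by fun_prop)) (Filter.Eventually.of_forall fun x => ?_)
  rw [Real.norm_of_nonneg (by positivity), ← div_eq_mul_inv, le_div_iff₀ (by positivity)]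
  refine le_trans (le_of_eq ?_) (hC x)
  rw [pow_add]
  ring

/-- The family of translates grows at most like `(1 + ‖x‖)^(2q)`, and `b` decays faster. -/
theorem integrable_smul_toBddFamily (q m : ℕ) (a b : 𝓢(Eucl d, ℂ)) :
    Integrable fun x => reflTranslate b 0 x • toBddFamily q m (reflTranslate a x) := by
  -- The target need not be separable; strong measurability of the continuous integrand comes from
  -- the separable domain.
  have : SecondCountableTopologyEither (Eucl d) (BddFamily d m) :=
    secondCountableTopologyEither_of_left _ _
  refine ((integrable_pow_mul_norm (2 * q) (reflTranslate b 0)).mul_const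
    (mu (2 * q) m a)).mono' (Continuous.aestronglyMeasurable
      ((reflTranslate b 0).continuous.smul (continuous_toBddFamily_reflTranslate q m a)))
    (Filter.Eventually.of_forall fun x => ?_)
  rw [norm_smul]
  calc _ ≤ ‖reflTranslate b 0 x‖ * ((1 + ‖x‖) ^ (2 * q) * mu (2 * q) m a) := by
        gcongr
        exact (norm_toBddFamily_le _ _ _).trans (mu_reflTranslate_le _ _ _ _)
    _ = _ := by ring

theorem lineDerivOp_compSubConst (v y : Eucl d) (f : 𝓢(Eucl d, ℂ)) :
    (∂_{v} (SchwartzMap.compSubConstCLM ℂ y f) : 𝓢(Eucl d, ℂ)) =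
      SchwartzMap.compSubConstCLM ℂ y (∂_{v} f : 𝓢(Eucl d, ℂ)) := by
  ext x
  rw [SchwartzMap.compSubConstCLM_apply, SchwartzMap.lineDerivOp_apply_eq_fderiv,
    SchwartzMap.lineDerivOp_apply_eq_fderiv]
  have h : (SchwartzMap.compSubConstCLM ℂ y f : Eucl d → ℂ) = fun x => f (x - y) := rfl
  have h2 : HasFDerivAt (fun x => f (x - y)) (fderiv ℝ f (x - y)) x :=
    (f.hasFDerivAt (x - y)).comp x ((hasFDerivAt_id x).sub_const y)
  rw [h, h2.fderiv]

/-- Each integration by parts gives a minus sign, cancelled by the one from differentiating the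
reflected `b`. -/
theorem integral_mul_partialDeriv_sub {n : ℕ} (s : Fin n → Fin d) (a b : 𝓢(Eucl d, ℂ))
    (y : Eucl d) :
    ∫ x, reflTranslate b 0 x * partialDeriv s a (x - y) =
      ∫ x, reflTranslate (partialDeriv s b) 0 x * a (x - y) := by
  induction n generalizing b with
  | zero => simp only [partialDeriv_zero]
  | succ n ih =>
    have h : ∀ x, partialDeriv s a (x - y) = (∂_{e (s 0)} (SchwartzMap.compSubConstCLM ℂ y
        (partialDeriv (Fin.tail s) a)) : 𝓢(Eucl d, ℂ)) x := fun x => by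
      rw [lineDerivOp_compSubConst, SchwartzMap.compSubConstCLM_apply, ← partialDeriv_succ]
    simp_rw [h]
    rw [SchwartzMap.integral_mul_lineDerivOp_right_eq_neg_left, lineDerivOp_reflTranslate,
      ← integral_neg]
    simp only [neg_apply, neg_mul, neg_neg, SchwartzMap.compSubConstCLM_apply]
    rw [ih, partialDeriv_lineDerivOp, ← partialDeriv_succ]

theorem integral_mul_partialDeriv_reflTranslate_comm {n : ℕ} (s : Fin n → Fin d)
    (a b : 𝓢(Eucl d, ℂ)) (y : Eucl d) :
    ∫ x, reflTranslate b 0 x * partialDeriv s (reflTranslate a x) y =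
      ∫ x, reflTranslate a 0 x * partialDeriv s (reflTranslate b x) y := by
  simp_rw [partialDeriv_reflTranslate, smul_apply, smul_eq_mul, mul_left_comm _ ((-1 : ℂ) ^ n),
    integral_const_mul]
  congr 1
  simp_rw [reflTranslate_apply _ _ y]
  -- The substitution `x ↦ y - x` then exchanges the roles of `a` and `b`.
  rw [integral_mul_partialDeriv_sub, ← integral_sub_left_eq_self _ volume y]
  refine integral_congr_ae (Filter.Eventually.of_forall fun x => ?_)
  simp only [reflTranslate_apply]
  rw [mul_comm]
  congr 2 <;> abel

/-- `((u * a) * b)(0) = ((u * b) * a)(0)`. -/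
theorem integral_mul_conv_comm {u : 𝓢'(Eucl d, ℂ)} (hu : u ∈ OC' d) (a b : 𝓢(Eucl d, ℂ)) :
    ∫ x, reflTranslate b 0 x * conv u a x = ∫ x, reflTranslate a 0 x * conv u b x := by
  obtain ⟨q, m, U, hU⟩ := exists_eq_comp_toBddFamily hu
  have key (a b : 𝓢(Eucl d, ℂ)) : ∫ x, reflTranslate b 0 x * conv u a x =
      U (∫ x, reflTranslate b 0 x • toBddFamily q m (reflTranslate a x)) := by
    rw [← U.integral_comp_comm (integrable_smul_toBddFamily q m a b)]
    refine integral_congr_ae (Filter.Eventually.of_forall fun x => ?_)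
    simp only [map_smul, smul_eq_mul, ← hU]
    rfl
  rw [key, key]
  congr 1
  -- The functional is gone: it remains to compare the two Bochner integrals, and evaluation at each
  -- component and point is a continuous functional that commutes with them.
  funext i
  ext y
  let L : BddFamily d m →L[ℂ] ℂ :=
    (BoundedContinuousFunction.evalCLM ℂ y).comp (ContinuousLinearMap.proj i)
  have hL (a b : 𝓢(Eucl d, ℂ)) :
      (∫ x, reflTranslate b 0 x • toBddFamily q m (reflTranslate a x)) i y =
        japanese (q : ℝ) y * ∫ x, reflTranslate b 0 x * partialDeriv i.2 (reflTranslate a x) y := by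
    change L _ = _
    rw [← L.integral_comp_comm (integrable_smul_toBddFamily q m a b), ← integral_const_mul]
    refine integral_congr_ae (Filter.Eventually.of_forall fun x => ?_)
    simp only [map_smul, smul_eq_mul]
    change _ * toBddFamily q m (reflTranslate a x) i y = _
    rw [toBddFamily_apply, mul_left_comm]
  rw [hL, hL, integral_mul_partialDeriv_reflTranslate_comm]

/-! ### Scaling -/

theorem lineDerivOp_scale (v : Eucl d) (ρ : 𝓢(Eucl d, ℂ)) (ε : Set.Ioc (0 : ℝ) 1) :
    (∂_{v} (scale ρ ε) : 𝓢(Eucl d, ℂ)) = (((ε : ℝ)⁻¹ : ℝ) : ℂ) • scale (∂_{v} ρ) ε := by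
  ext x
  have h2 : HasFDerivAt (scale ρ ε) ((((ε : ℝ) ^ d)⁻¹ : ℂ) • (fderiv ℝ ρ ((ε : ℝ)⁻¹ • x)).comp
      ((ε : ℝ)⁻¹ • ContinuousLinearMap.id ℝ (Eucl d))) x :=
    ((ρ.hasFDerivAt ((ε : ℝ)⁻¹ • x)).comp x
      ((hasFDerivAt_id x).const_smul (ε : ℝ)⁻¹)).const_smul (((ε : ℝ) ^ d)⁻¹ : ℂ)
  rw [SchwartzMap.lineDerivOp_apply_eq_fderiv, h2.fderiv, smul_apply, smul_apply,
    scale_apply, SchwartzMap.lineDerivOp_apply_eq_fderiv]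
  simp
  ring

theorem partialDeriv_scale {n : ℕ} (s : Fin n → Fin d) (ρ : 𝓢(Eucl d, ℂ))
    (ε : Set.Ioc (0 : ℝ) 1) :
    partialDeriv s (scale ρ ε) = (((ε : ℝ)⁻¹ : ℝ) : ℂ) ^ n • scale (partialDeriv s ρ) ε := by
  induction n with
  | zero => simp [partialDeriv_zero]
  | succ n ih =>
    rw [partialDeriv_succ, ih, lineDerivOp_smul, lineDerivOp_scale, ← partialDeriv_succ, smul_smul,
      pow_succ]

/-- Each derivative costs `ε⁻¹` and the normalization costs `ε^(-d)`; the weight costs nothing, as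
`‖x‖ ≤ ‖x/ε‖` for `ε ≤ 1`. -/
theorem mu_scale_le (q m : ℕ) (ρ : 𝓢(Eucl d, ℂ)) (ε : Set.Ioc (0 : ℝ) 1) :
    mu q m (scale ρ ε) ≤ (ε : ℝ)⁻¹ ^ (m + d) * mu q m ρ := by
  have h0 : (0 : ℝ) < ε := ε.2.1
  have h1 : 1 ≤ (ε : ℝ)⁻¹ := (one_le_inv₀ h0).2 ε.2.2
  refine mu_le fun n hn s x => ?_
  rw [partialDeriv_scale, smul_apply, scale_apply, norm_smul, norm_mul, norm_pow, norm_inv,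
    norm_pow, Complex.norm_real, Complex.norm_real, Real.norm_of_nonneg h0.le,
    Real.norm_of_nonneg (inv_nonneg.2 h0.le), ← inv_pow]
  have h2 : ‖x‖ ≤ ‖(ε : ℝ)⁻¹ • x‖ := by
    rw [norm_smul, Real.norm_of_nonneg (inv_nonneg.2 h0.le)]
    exact le_mul_of_one_le_left (norm_nonneg _) h1
  calc _ = (ε : ℝ)⁻¹ ^ (n + d) * ((1 + ‖x‖) ^ q * ‖partialDeriv s ρ ((ε : ℝ)⁻¹ • x)‖) := by
        rw [pow_add]
        ring
    _ ≤ (ε : ℝ)⁻¹ ^ (m + d) *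
          ((1 + ‖(ε : ℝ)⁻¹ • x‖) ^ q * ‖partialDeriv s ρ ((ε : ℝ)⁻¹ • x)‖) := by
        gcongr
    _ ≤ _ := by
        gcongr
        exact le_mu hn s ρ _

/-! ### The embedding -/

/-- The net `(u * ρ_ε)_ε`. -/
def convNet (ρ : 𝓢(Eucl d, ℂ)) : OC' d →ₗ[ℂ] XS d where
  toFun u := ⟨fun ε => convSchwartz u (scale ρ ε), by
    choose C q' l' hC0 hC using exists_mu_convSchwartz_le u
    refine ⟨fun q l => ((l' q l + d : ℕ) : ℝ≥0), fun q l => ?_⟩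
    refine Asymptotics.IsBigO.of_bound (C q l * mu (q' q l) (l' q l) ρ)
      (Filter.Eventually.of_forall fun ε => ?_)
    have h0 : (0 : ℝ) < ε := ε.2.1
    rw [Real.norm_of_nonneg (mu_nonneg _ _ _), Real.norm_of_nonneg (by positivity),
      NNReal.coe_natCast, Real.rpow_neg h0.le, Real.rpow_natCast, ← inv_pow]
    calc _ ≤ C q l * mu (q' q l) (l' q l) (scale ρ ε) := hC q l _
      _ ≤ C q l * ((ε : ℝ)⁻¹ ^ (l' q l + d) * mu (q' q l) (l' q l) ρ) :=
        mul_le_mul_of_nonneg_left (mu_scale_le _ _ _ _) (hC0 q l)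
      _ = _ := by ring⟩
  map_add' _ _ := rfl
  map_smul' _ _ := rfl

theorem convNet_apply (ρ : 𝓢(Eucl d, ℂ)) (u : OC' d) (ε : Set.Ioc (0 : ℝ) 1) :
    (convNet ρ u).1 ε = convSchwartz u (scale ρ ε) := rfl

/-! ### The limit `ε → 0` and injectivity -/

instance epsToZero_neBot : epsToZero.NeBot := by
  refine mem_closure_iff_comap_neBot.1 ?_
  rw [closure_Ioc zero_ne_one]
  exact Set.left_mem_Icc.2 zero_le_one

instance epsToZero_isCountablyGenerated : epsToZero.IsCountablyGenerated :=
  Filter.comap.isCountablyGenerated _ _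

theorem tendsto_epsToZero :
    Filter.Tendsto (fun ε : Set.Ioc (0 : ℝ) 1 => (ε : ℝ)) epsToZero (𝓝 0) :=
  Filter.tendsto_comap

/-- Moving `ε` from the mollifier to `B` fixes the integrable factor, as dominated convergence
requires. -/
theorem integral_reflTranslate_scale_mul (ρ B : 𝓢(Eucl d, ℂ)) (ε : Set.Ioc (0 : ℝ) 1) :
    ∫ x, reflTranslate (scale ρ ε) 0 x * B x = ∫ x, reflTranslate ρ 0 x * B ((ε : ℝ) • x) := by
  have h0 : (0 : ℝ) < ε := ε.2.1
  have h := Measure.integral_comp_smul (volume : Measure (Eucl d))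
    (fun x => reflTranslate ρ 0 x * B ((ε : ℝ) • x)) (ε : ℝ)⁻¹
  rw [finrank_euclideanSpace_fin, inv_pow, inv_inv, abs_of_pos (by positivity)] at h
  have h1 : ∀ x : Eucl d, reflTranslate (scale ρ ε) 0 x * B x = (((ε : ℝ) ^ d)⁻¹ : ℂ) *
      (reflTranslate ρ 0 ((ε : ℝ)⁻¹ • x) * B ((ε : ℝ) • (ε : ℝ)⁻¹ • x)) := fun x => by
    rw [smul_inv_smul₀ h0.ne', reflTranslate_apply, reflTranslate_apply, scale_apply, zero_sub,
      zero_sub, smul_neg, mul_assoc]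
  simp_rw [h1]
  rw [integral_const_mul, h, Complex.real_smul]
  have h2 : ((ε : ℝ) : ℂ) ≠ 0 := Complex.ofReal_ne_zero.2 h0.ne'
  push_cast
  rw [inv_mul_cancel_left₀ (pow_ne_zero d h2)]

/-- The mollifiers form an approximate identity. -/
theorem tendsto_integral_scale_mul {ρ : 𝓢(Eucl d, ℂ)} (hρ : ∫ x, ρ x = 1) (B : 𝓢(Eucl d, ℂ)) :
    Filter.Tendsto (fun ε => ∫ x, reflTranslate (scale ρ ε) 0 x * B x) epsToZero (𝓝 (B 0)) := by
  simp_rw [integral_reflTranslate_scale_mul]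
  have hlim : ∫ x, reflTranslate ρ 0 x * B 0 = B 0 := by
    rw [integral_mul_const]
    simp_rw [reflTranslate_apply]
    rw [integral_sub_left_eq_self (fun x => ρ x) volume 0, hρ, one_mul]
  obtain ⟨M, hM0, hM⟩ := exists_pow_mul_norm_le 0 B
  rw [← hlim]
  refine tendsto_integral_filter_of_dominated_convergence (fun x => ‖reflTranslate ρ 0 x‖ * M)
    (Filter.Eventually.of_forall fun ε => ?_) (Filter.Eventually.of_forall fun ε =>
      Filter.Eventually.of_forall fun x => ?_) ((reflTranslate ρ 0).integrable.norm.mul_const M)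
    (Filter.Eventually.of_forall fun x => ?_)
  · exact Continuous.aestronglyMeasurable ((reflTranslate ρ 0).continuous.mul
      (B.continuous.comp (continuous_const_smul _)))
  · rw [norm_mul]
    gcongr
    simpa using hM ((ε : ℝ) • x)
  · refine Filter.Tendsto.const_mul _ ?_
    have h : Filter.Tendsto (fun ε : Set.Ioc (0 : ℝ) 1 => (ε : ℝ) • x) epsToZero (𝓝 0) := by
      simpa using tendsto_epsToZero.smul_const x
    exact (B.continuous.tendsto 0).comp h

theorem tendsto_integral_mul_of_mem_NS {f : Net d} (hf : f ∈ NS d) (b : 𝓢(Eucl d, ℂ)) :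
    Filter.Tendsto (fun ε => ∫ x, b x * f ε x) epsToZero (𝓝 0) := by
  have h1 : Filter.Tendsto (fun ε => mu 0 0 (f ε)) epsToZero (𝓝 0) :=
    -- The sup norm being `O(ε)` already suffices.
    (hf 0 0 1).trans_tendsto (by simpa using tendsto_epsToZero)
  refine squeeze_zero_norm (a := fun ε => (∫ x, ‖b x‖) * mu 0 0 (f ε)) (fun ε => ?_)
    (by simpa using h1.const_mul (∫ x, ‖b x‖))
  rw [← integral_mul_const]
  refine norm_integral_le_of_norm_le (b.integrable.norm.mul_const _)
    (Filter.Eventually.of_forall fun x => ?_)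
  rw [norm_mul]
  gcongr
  have := le_mu (q := 0) le_rfl (fun i : Fin 0 => i.elim0) (f ε) x
  simpa [partialDeriv_zero] using this

theorem eq_zero_of_convNet_mem_NS {ρ : 𝓢(Eucl d, ℂ)} (hρ : ∫ x, ρ x = 1) {u : OC' d}
    (h : (convNet ρ u).1 ∈ NS d) : u = 0 := by
  have key (b : 𝓢(Eucl d, ℂ)) : conv u.1 b 0 = 0 := by
    have h1 := tendsto_integral_mul_of_mem_NS h (reflTranslate b 0)
    have h2 := tendsto_integral_scale_mul hρ (convSchwartz u b)
    simp only [convNet_apply, convSchwartz_apply, integral_mul_conv_comm u.2 _ b] at h1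
    exact tendsto_nhds_unique h2 h1
  refine Subtype.ext ?_
  ext ψ
  -- Reflection is an involution, so the vanishing of all `(u * b)(0)` covers every test function.
  have h1 : ψ = reflTranslate (reflTranslate ψ 0) 0 := by
    ext x
    simp [reflTranslate_apply]
  rw [h1]
  exact key _

end RapidlyDecreasing

end

theorem mainTheorem6 (d : ℕ) (ρ : 𝓢(RapidlyDecreasing.Eucl d, ℂ))
    (hρ : RapidlyDecreasing.IsMollifier ρ) :
    ∃ ι : RapidlyDecreasing.OC' d →ₗ[ℂ] RapidlyDecreasing.GS d,
      (∀ u : RapidlyDecreasing.OC' d, ∃ f : RapidlyDecreasing.XS d,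
        (∀ (ε : Set.Ioc (0 : ℝ) 1) (x : RapidlyDecreasing.Eucl d),
          f.1 ε x = RapidlyDecreasing.conv u.1 (RapidlyDecreasing.scale ρ ε) x) ∧
        ι u = RapidlyDecreasing.GS.mk f) ∧
      Function.Injective ι ∧
      ∀ (j : Fin d) (u : RapidlyDecreasing.OC' d),
        ∃ h : (∂_{RapidlyDecreasing.e j} u.1 : 𝓢'(RapidlyDecreasing.Eucl d, ℂ)) ∈
            RapidlyDecreasing.OC' d,
          ι ⟨_, h⟩ = RapidlyDecreasing.GS.pderiv j (ι u) := by
  refine ⟨RapidlyDecreasing.GS.mk.comp (RapidlyDecreasing.convNet ρ),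
    fun u => ⟨RapidlyDecreasing.convNet ρ u, fun ε x => rfl, rfl⟩, ?_, fun j u =>
    ⟨RapidlyDecreasing.lineDerivOp_mem_OC' u.2 j, ?_⟩⟩
  · refine (injective_iff_map_eq_zero _).2 fun u hu => ?_
    refine RapidlyDecreasing.eq_zero_of_convNet_mem_NS hρ.integral_eq_one ?_
    have h := (Submodule.Quotient.mk_eq_zero
      ((RapidlyDecreasing.NS d).submoduleOf (RapidlyDecreasing.XS d))).1 hu
    exact h
  · rw [LinearMap.comp_apply, LinearMap.comp_apply, RapidlyDecreasing.GS.pderiv_mk]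
    congr 1
    refine Subtype.ext (funext fun ε => ?_)
    exact RapidlyDecreasing.convSchwartz_lineDerivOp u j _ _
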